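/- Let $\tau$ be a probability measure on $\mathbb R$ that is not a Dirac mass, let $p>0$ be real, and suppose $\int |t|^{2p}\,d\tau(t)<\infty$. For $x,y\in\mathbb R^d$ let $d_p(x,y)=\big(\sum_{k=1}^d|x^k-y^k|^p\big)^{\min(1,p)/p}$. Given $N$ i.i.d. nodes in $\mathbb R^d$, all of whose coordinates are i.i.d. with law $\tau$, the hard random geometric graph (RGG) with cutoff $r\ge 0$ links two distinct nodes if and only if their distance $d_p$ is at most $r$. With $y_1,y_2,\dots$ i.i.d. of law $\tau$, put $$\mu=\mathbb E|y_1-y_2|^p,\quad \alpha=\mathbb E|y_1-y_2|^{2p}-\mu^2,\quad \beta=\mathbb E\big[|y_1-y_2|^p|y_1-y_3|^p\big]-\mu^2,$$ and for $M\ge 0$ let $\Sigma$ be the $\binom M2\times\binom M2$ matrix, indexed by pairs $i<j$ in $\{1,\dots,M\}$, with entries $$\Sigma_{(i,j),(k,l)}=\mathbb E\big[(|y_i-y_j|^p-\mu)(|y_k-y_l|^p-\mu)\big].$$ Then the following hold for every $M\ge 0$. 1. $\Sigma=\alpha I+\beta J$, where $J$ is the adjacency matrix of the Johnson graph $J(M,2)$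 (two distinct pairs are adjacent when they share a node), and $\Sigma$ is positive definite. Hence $$\overline\rho_M(x)=\int_{\mathbb R^{\binom M2}}\mathcal N(0,\Sigma)(q)\prod_{i<j}\theta(x-q_{ij})\,dq,\qquad \mathcal N(0,\Sigma)(q)=\frac{e^{-\frac12 q^T\Sigma^{-1}q}}{\sqrt{(2\pi)^{\binom M2}\det\Sigma}},$$ is well defined for every $x\in\mathbb R$; here $\theta$ is the Heaviside function. 2. Let $x\in\mathbb R$, and let the cutoffs $r_d\ge0$ satisfy $r_d^{\max(1,p)}=d\mu+x\sqrt d$ for all large $d$. Let $N_d$ be any numbers of nodes, and for each $d$ choose any $M$ of the $N_d$ nodes. Then the probability that the chosen nodes form an $M$-clique in the hard RGG with cutoff $r_d$ on $N_d$ nodes in $\mathbb R^d$ tends to $\overline\rho_M(x)$ as $d\to\infty$. 3. $\alpha>0$, and for $M=2$ and every $x\in\mathbb R$, $\overline\rho_2(x)=\tfrac12\big[1+\mathrm{Erf}\big(x/\sqrt{2\alpha}\big)\big]$. 4. $\overline\rho_2$ is a bijection from $\mathbb R$ onto $(0,1)$, so that $\omega_M(u)=\overline\rho_M\big(\overline\rho_2^{-1}(u)\big)$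 gives the limiting $M$-clique probability as a function of the limiting linking probability $u\in(0,1)$. In general it differs from the Erdős–Rényi value $u^{\binom M2}$: if $M\ge3$ and $\beta\neq0$, then $\omega_M(u)\ne u^{\binom M2}$ for every $u\in(0,1)$. The condition $\beta\ne0$ holds for every $p>0$ when $\tau$ is the uniform law on $[0,1]$. -/

import Mathlib

open MeasureTheory

noncomputable section

namespace HighDimRGG

/-- The distance `d_p(x, y) = ‖x - y‖_p ^ min(1, p)` on `ℝ^d`, for real `p > 0`. -/
def pDist (p : ℝ) {d : ℕ} (x y : Fin d → ℝ) : ℝ :=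
  ((∑ k, |x k - y k| ^ p) ^ (1 / p)) ^ min 1 p

/-- The hard geometric graph with cutoff `r` on the points `X v`, `v : V`: distinct nodes are
linked if and only if their distance does not exceed `r`. -/
def hardGraph (p r : ℝ) {d : ℕ} {V : Type*} (X : V → Fin d → ℝ) : SimpleGraph V where
  Adj v w := v ≠ w ∧ pDist p (X v) (X w) ≤ r
  symm := ⟨fun v w h => ⟨h.1.symm, by
    have e : pDist p (X w) (X v) = pDist p (X v) (X w) := by
      simp only [pDist, abs_sub_comm]
    rw [e]; exact h.2⟩⟩
  loopless := ⟨fun _ h => h.1 rfl⟩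

/-- The law of `N` i.i.d. nodes in `ℝ^d` whose coordinates are i.i.d. with law `τ`. -/
def nodeLaw (τ : Measure ℝ) (d N : ℕ) : Measure (Fin N → Fin d → ℝ) :=
  Measure.pi fun _ => Measure.pi fun _ => τ

/-- The probability that the nodes in `s` form an `M`-clique in the hard random geometric graph
with `N` nodes in `ℝ^d` and cutoff `r`. -/
def cliqueProb (τ : Measure ℝ) (p : ℝ) (d : ℕ) (r : ℝ) (M : ℕ) {N : ℕ} (s : Finset (Fin N)) : ℝ :=
  (nodeLaw τ d N).real {X | (hardGraph p r X).IsNClique M s}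

/-- `μ = E |y₁ - y₂|^p`. -/
def meanDist (τ : Measure ℝ) (p : ℝ) : ℝ := ∫ x, ∫ y, |x - y| ^ p ∂τ ∂τ

/-- The diagonal correlation `α = E |y₁ - y₂|^(2p) - μ²`. -/
def diagCorr (τ : Measure ℝ) (p : ℝ) : ℝ :=
  (∫ x, ∫ y, |x - y| ^ (2 * p) ∂τ ∂τ) - meanDist τ p ^ 2

/-- The triangular correlation `β = E |y₁ - y₂|^p |y₁ - y₃|^p - μ²`. -/
def triCorr (τ : Measure ℝ) (p : ℝ) : ℝ :=
  (∫ x, ∫ y, ∫ z, |x - y| ^ p * |x - z| ^ p ∂τ ∂τ ∂τ) - meanDist τ p ^ 2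

/-- The pairs `(i, j)` with `i < j` of nodes among `M`. -/
abbrev Pairs (M : ℕ) : Type := {e : Fin M × Fin M // e.1 < e.2}

/-- The Johnson graph `J(M, 2)`: two distinct pairs are adjacent if they share a node. -/
def johnsonGraph (M : ℕ) : SimpleGraph (Pairs M) where
  Adj e f := e ≠ f ∧ (e.1.1 = f.1.1 ∨ e.1.1 = f.1.2 ∨ e.1.2 = f.1.1 ∨ e.1.2 = f.1.2)
  symm := ⟨fun e f h => ⟨h.1.symm, by
    rcases h.2 with h | h | h | h <;> simp [h]⟩⟩
  loopless := ⟨fun _ h => h.1 rfl⟩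

instance (M : ℕ) : DecidableRel (johnsonGraph M).Adj := fun e f =>
  inferInstanceAs (Decidable
    (e ≠ f ∧ (e.1.1 = f.1.1 ∨ e.1.1 = f.1.2 ∨ e.1.2 = f.1.1 ∨ e.1.2 = f.1.2)))

/-- The covariance matrix `Σ_{(i,j),(k,l)} = E (|y_i - y_j|^p - μ) (|y_k - y_l|^p - μ)`, where
`y_1, …, y_M` are i.i.d. with law `τ`. -/
def covMatrix (τ : Measure ℝ) (p : ℝ) (M : ℕ) : Matrix (Pairs M) (Pairs M) ℝ := fun e f =>
  ∫ y : Fin M → ℝ, (|y e.1.1 - y e.1.2| ^ p - meanDist τ p) *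
    (|y f.1.1 - y f.1.2| ^ p - meanDist τ p) ∂(Measure.pi fun _ => τ)

/-- The density of the centred Gaussian law with invertible covariance matrix `S`. -/
def gaussianDensity {ι : Type*} [Fintype ι] [DecidableEq ι] (S : Matrix ι ι ℝ) (q : ι → ℝ) : ℝ :=
  Real.exp (-(1 / 2) * (q ⬝ᵥ (S⁻¹.mulVec q))) /
    Real.sqrt ((2 * Real.pi) ^ Fintype.card ι * S.det)

/-- The Heaviside function. -/
def heaviside (t : ℝ) : ℝ := if 0 ≤ t then 1 else 0

/-- The Gaussian orthant probability `∫ N(0, Σ)(q) ∏_{i<j} θ(x - q_{ij}) dq`. -/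
def limitDensity (τ : Measure ℝ) (p : ℝ) (M : ℕ) (x : ℝ) : ℝ :=
  ∫ q : Pairs M → ℝ, gaussianDensity (covMatrix τ p M) q * ∏ e : Pairs M, heaviside (x - q e)

/-- The limiting `M`-clique probability as a function of the limiting linking probability `u`
of two nodes: the composition of the `M`-clique limit with the inverse of the `2`-clique limit. -/
def omegaHard (τ : Measure ℝ) (p : ℝ) (M : ℕ) (u : ℝ) : ℝ :=
  limitDensity τ p M (Function.invFun (limitDensity τ p 2) u)

/-- The error function. -/
def erf (z : ℝ) : ℝ := 2 / Real.sqrt Real.pi * ∫ t in (0 : ℝ)..z, Real.exp (-t ^ 2)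

end HighDimRGG

end

noncomputable section

namespace HighDimRGG

open ProbabilityTheory

/-! ### Product measures -/

lemma measurePreserving_pi_comp_injective {ι κ Ω : Type*} [Fintype ι] [Fintype κ]
    [MeasurableSpace Ω] (P : Measure Ω) [IsProbabilityMeasure P] {e : ι → κ}
    (he : Function.Injective e) :
    MeasurePreserving (fun (x : κ → Ω) i => x (e i)) (Measure.pi fun _ => P)
      (Measure.pi fun _ => P) where
  measurable := by fun_prop
  map_eq := by
    have h : iIndepFun (fun (i : κ) (x : κ → Ω) => x i) (Measure.pi fun _ : κ => P) :=
      iIndepFun_pi (X := fun _ => id) (fun _ => aemeasurable_id)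
    have h' := (iIndepFun_iff_map_fun_eq_pi_map
      (fun i => (measurable_pi_apply (e i)).aemeasurable)).1 (h.precomp he)
    rw [h']
    congr 1
    ext1 i
    exact (measurePreserving_eval (fun _ : κ => P) (e i)).map_eq

lemma measurePreserving_pi_curry {ι κ Ω : Type*} [Fintype ι] [Fintype κ]
    [MeasurableSpace Ω] (P : Measure Ω) [IsProbabilityMeasure P] :
    MeasurePreserving (MeasurableEquiv.curry ι κ Ω) (Measure.pi fun _ => P)
      (Measure.pi fun _ => Measure.pi fun _ => P) := by
  refine ⟨MeasurableEquiv.measurable _, ?_⟩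
  have := Measure.infinitePi_map_curry (μ := fun (_ : ι) (_ : κ) => P)
  simpa only [Measure.infinitePi_eq_pi] using this

lemma measurePreserving_pi_swap {ι κ Ω : Type*} [Fintype ι] [Fintype κ]
    [MeasurableSpace Ω] (P : Measure Ω) [IsProbabilityMeasure P] :
    MeasurePreserving (fun (x : ι → κ → Ω) k i => x i k)
      (Measure.pi fun _ => Measure.pi fun _ => P) (Measure.pi fun _ => Measure.pi fun _ => P) := by
  have h1 := (measurePreserving_pi_curry (ι := ι) (κ := κ) P).symm
  have h2 := measurePreserving_pi_comp_injective P (Prod.swap_injective (α := κ) (β := ι))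
  exact (measurePreserving_pi_curry P).comp (h2.comp h1)

lemma integral_pi_succ {n : ℕ} {Ω : Type*} [MeasurableSpace Ω] (P : Measure Ω)
    [IsProbabilityMeasure P] (F : (Fin (n + 1) → Ω) → ℝ)
    (hF : Integrable F (Measure.pi fun _ => P)) :
    Integrable (fun z : Ω × (Fin n → Ω) => F (Fin.cons z.1 z.2)) (P.prod (Measure.pi fun _ => P)) ∧
    ∫ y, F y ∂(Measure.pi fun _ => P) =
      ∫ x, ∫ z, F (Fin.cons x z) ∂(Measure.pi fun _ => P) ∂P := by
  have h := (measurePreserving_piFinSuccAbove (fun _ : Fin (n + 1) => P) 0).symm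
  have e : ∀ z : Ω × (Fin n → Ω), (MeasurableEquiv.piFinSuccAbove (fun _ => Ω) 0).symm z
      = (Fin.cons z.1 z.2 : Fin (n + 1) → Ω) := by
    intro z
    simp [MeasurableEquiv.piFinSuccAbove]
    rfl
  have hi : Integrable (fun z : Ω × (Fin n → Ω) => F (Fin.cons z.1 z.2))
      (P.prod (Measure.pi fun _ => P)) := by
    have := (h.integrable_comp_emb (MeasurableEquiv.measurableEmbedding _)).2 hF
    refine this.congr (ae_of_all _ fun z => ?_)
    simp only [Function.comp, e]
  refine ⟨hi, ?_⟩
  rw [← integral_prod _ hi, ← h.integral_comp']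
  simp only [e]

/-! ### Moments of the coordinate distances -/

section Moments

variable {τ : Measure ℝ} {p : ℝ}

lemma measurable_abs_sub_rpow {Ω : Type*} [MeasurableSpace Ω] {f g : Ω → ℝ} (p : ℝ)
    (hf : Measurable f) (hg : Measurable g) : Measurable fun ω => |f ω - g ω| ^ p := by
  fun_prop

lemma abs_sub_rpow_le {q : ℝ} (hq : 0 ≤ q) (a b : ℝ) :
    |a - b| ^ q ≤ 2 ^ q * (|a| ^ q + |b| ^ q) := by
  have h1 : |a - b| ≤ 2 * max |a| |b| := by
    have := abs_sub a b
    have := le_max_left |a| |b|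
    have := le_max_right |a| |b|
    linarith
  have h2 : |a - b| ^ q ≤ 2 ^ q * (max |a| |b|) ^ q := by
    rw [← Real.mul_rpow (by norm_num) (by positivity)]
    exact Real.rpow_le_rpow (abs_nonneg _) h1 hq
  refine h2.trans (mul_le_mul_of_nonneg_left ?_ (by positivity))
  have ha : 0 ≤ |a| ^ q := by positivity
  have hb : 0 ≤ |b| ^ q := by positivity
  rcases max_choice |a| |b| with h | h <;> rw [h] <;> linarith

lemma memLp_abs_sub_rpow [IsProbabilityMeasure τ] (hp : 0 < p)
    (hmom : Integrable (fun t : ℝ => |t| ^ (2 * p)) τ) {ι : Type*} [Fintype ι] (i j : ι) :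
    MemLp (fun y : ι → ℝ => |y i - y j| ^ p) 2 (Measure.pi fun _ => τ) := by
  have hm : Measurable fun y : ι → ℝ => |y i - y j| ^ p :=
    measurable_abs_sub_rpow p (measurable_pi_apply i) (measurable_pi_apply j)
  rw [memLp_two_iff_integrable_sq hm.aestronglyMeasurable]
  have hi : ∀ k : ι, Integrable (fun y : ι → ℝ => |y k| ^ (2 * p)) (Measure.pi fun _ => τ) :=
    fun k => integrable_comp_eval (μ := fun _ : ι => τ) (i := k) hmom
  refine Integrable.mono' (((hi i).add (hi j)).const_mul (2 ^ (2 * p)))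
    (hm.pow_const 2).aestronglyMeasurable (ae_of_all _ fun y => ?_)
  have e : (|y i - y j| ^ p) ^ 2 = |y i - y j| ^ (2 * p) := by
    rw [mul_comm, Real.rpow_mul (abs_nonneg _), Real.rpow_two]
  rw [e, Real.norm_of_nonneg (by positivity)]
  exact abs_sub_rpow_le (by positivity) _ _

lemma integrable_abs_sub_rpow_mul [IsProbabilityMeasure τ] (hp : 0 < p)
    (hmom : Integrable (fun t : ℝ => |t| ^ (2 * p)) τ) {ι : Type*} [Fintype ι] (i j k l : ι) :
    Integrable (fun y : ι → ℝ => |y i - y j| ^ p * |y k - y l| ^ p) (Measure.pi fun _ => τ) :=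
  (memLp_abs_sub_rpow hp hmom i j).integrable_mul (memLp_abs_sub_rpow hp hmom k l)

lemma integrable_abs_sub_rpow [IsProbabilityMeasure τ] (hp : 0 < p)
    (hmom : Integrable (fun t : ℝ => |t| ^ (2 * p)) τ) {ι : Type*} [Fintype ι] (i j : ι) :
    Integrable (fun y : ι → ℝ => |y i - y j| ^ p) (Measure.pi fun _ => τ) :=
  (memLp_abs_sub_rpow hp hmom i j).integrable one_le_two

lemma integral_pi_two {Ω : Type*} [MeasurableSpace Ω] (P : Measure Ω)
    [IsProbabilityMeasure P] (F : Ω → Ω → ℝ)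
    (hF : Integrable (fun y : Fin 2 → Ω => F (y 0) (y 1)) (Measure.pi fun _ => P)) :
    ∫ y : Fin 2 → Ω, F (y 0) (y 1) ∂(Measure.pi fun _ => P) = ∫ x, ∫ y, F x y ∂P ∂P := by
  obtain ⟨h1, e1⟩ := integral_pi_succ P _ hF
  rw [e1]
  refine integral_congr_ae ?_
  filter_upwards [h1.prod_right_ae] with x hx
  obtain ⟨h2, e2⟩ := integral_pi_succ P _ hx
  rw [e2]
  simp

lemma integral_pi_three {Ω : Type*} [MeasurableSpace Ω] (P : Measure Ω)
    [IsProbabilityMeasure P] (F : Ω → Ω → Ω → ℝ)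
    (hF : Integrable (fun y : Fin 3 → Ω => F (y 0) (y 1) (y 2)) (Measure.pi fun _ => P)) :
    ∫ y : Fin 3 → Ω, F (y 0) (y 1) (y 2) ∂(Measure.pi fun _ => P) =
      ∫ x, ∫ y, ∫ z, F x y z ∂P ∂P ∂P := by
  obtain ⟨h1, e1⟩ := integral_pi_succ P _ hF
  rw [e1]
  refine integral_congr_ae ?_
  filter_upwards [h1.prod_right_ae] with x hx
  exact integral_pi_two P (fun y z => F x y z) hx

lemma integral_pi_four {Ω : Type*} [MeasurableSpace Ω] (P : Measure Ω)
    [IsProbabilityMeasure P] (F : Ω → Ω → Ω → Ω → ℝ)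
    (hF : Integrable (fun y : Fin 4 → Ω => F (y 0) (y 1) (y 2) (y 3)) (Measure.pi fun _ => P)) :
    ∫ y : Fin 4 → Ω, F (y 0) (y 1) (y 2) (y 3) ∂(Measure.pi fun _ => P) =
      ∫ x, ∫ y, ∫ z, ∫ w, F x y z w ∂P ∂P ∂P ∂P := by
  obtain ⟨h1, e1⟩ := integral_pi_succ P _ hF
  rw [e1]
  refine integral_congr_ae ?_
  filter_upwards [h1.prod_right_ae] with x hx
  exact integral_pi_three P (fun y z w => F x y z w) hx

lemma integral_comp_injective {ι κ Ω : Type*} [Fintype ι] [Fintype κ] [MeasurableSpace Ω]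
    (P : Measure Ω) [IsProbabilityMeasure P] {e : ι → κ} (he : Function.Injective e)
    {F : (ι → Ω) → ℝ} (hF : Measurable F) :
    ∫ y : κ → Ω, F (fun i => y (e i)) ∂(Measure.pi fun _ => P) =
      ∫ y, F y ∂(Measure.pi fun _ => P) := by
  have h := measurePreserving_pi_comp_injective P he
  rw [← h.map_eq, integral_map h.measurable.aemeasurable hF.aestronglyMeasurable]

lemma integral_abs_sub_rpow [IsProbabilityMeasure τ] (hp : 0 < p)
    (hmom : Integrable (fun t : ℝ => |t| ^ (2 * p)) τ) {ι : Type*} [Fintype ι]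
    {i j : ι} (hij : i ≠ j) :
    ∫ y : ι → ℝ, |y i - y j| ^ p ∂(Measure.pi fun _ => τ) = meanDist τ p := by
  have he : Function.Injective ![i, j] := by
    intro a b; fin_cases a <;> fin_cases b <;> simp [hij, hij.symm]
  have h := integral_comp_injective τ he (F := fun y => |y 0 - y 1| ^ p) (by fun_prop)
  exact h.trans (integral_pi_two τ (fun x y => |x - y| ^ p)
    (integrable_abs_sub_rpow hp hmom 0 1))

lemma integral_abs_sub_rpow_two_mul [IsProbabilityMeasure τ] (hp : 0 < p)
    (hmom : Integrable (fun t : ℝ => |t| ^ (2 * p)) τ) {ι : Type*} [Fintype ι]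
    {i j : ι} (hij : i ≠ j) :
    ∫ y : ι → ℝ, |y i - y j| ^ p * |y i - y j| ^ p ∂(Measure.pi fun _ => τ) =
      diagCorr τ p + meanDist τ p ^ 2 := by
  have he : Function.Injective ![i, j] := by
    intro a b; fin_cases a <;> fin_cases b <;> simp [hij, hij.symm]
  have h := integral_comp_injective τ he
    (F := fun y => |y 0 - y 1| ^ p * |y 0 - y 1| ^ p) (by fun_prop)
  have h2 := integral_pi_two τ (fun x y => |x - y| ^ p * |x - y| ^ p)
    (integrable_abs_sub_rpow_mul hp hmom 0 1 0 1)
  refine (h.trans h2).trans ?_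
  have e : ∀ a b : ℝ, |a - b| ^ p * |a - b| ^ p = |a - b| ^ (2 * p) := fun a b => by
    rw [mul_comm 2 p, Real.rpow_mul (abs_nonneg _), Real.rpow_two, sq]
  simp only [e, diagCorr, sub_add_cancel]

lemma integral_abs_sub_rpow_mul_share [IsProbabilityMeasure τ] (hp : 0 < p)
    (hmom : Integrable (fun t : ℝ => |t| ^ (2 * p)) τ) {ι : Type*} [Fintype ι]
    {i j k : ι} (hij : i ≠ j) (hik : i ≠ k) (hjk : j ≠ k) :
    ∫ y : ι → ℝ, |y i - y j| ^ p * |y i - y k| ^ p ∂(Measure.pi fun _ => τ) =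
      triCorr τ p + meanDist τ p ^ 2 := by
  have he : Function.Injective ![i, j, k] := by
    intro a b; fin_cases a <;> fin_cases b <;> simp [hij, hij.symm, hik, hik.symm, hjk, hjk.symm]
  have h := integral_comp_injective τ he
    (F := fun y => |y 0 - y 1| ^ p * |y 0 - y 2| ^ p) (by fun_prop)
  have h2 := integral_pi_three τ (fun x y z => |x - y| ^ p * |x - z| ^ p)
    (integrable_abs_sub_rpow_mul hp hmom 0 1 0 2)
  refine (h.trans h2).trans ?_
  simp only [triCorr, sub_add_cancel]

lemma integral_abs_sub_rpow_mul_disjoint [IsProbabilityMeasure τ] (hp : 0 < p)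
    (hmom : Integrable (fun t : ℝ => |t| ^ (2 * p)) τ) {ι : Type*} [Fintype ι]
    {i j k l : ι} (hij : i ≠ j) (hik : i ≠ k) (hil : i ≠ l) (hjk : j ≠ k) (hjl : j ≠ l)
    (hkl : k ≠ l) :
    ∫ y : ι → ℝ, |y i - y j| ^ p * |y k - y l| ^ p ∂(Measure.pi fun _ => τ) =
      meanDist τ p ^ 2 := by
  have he : Function.Injective ![i, j, k, l] := by
    intro a b; fin_cases a <;> fin_cases b <;>
      simp [hij, hij.symm, hik, hik.symm, hjk, hjk.symm, hil, hil.symm, hjl, hjl.symm,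
        hkl, hkl.symm]
  have h := integral_comp_injective τ he
    (F := fun y => |y 0 - y 1| ^ p * |y 2 - y 3| ^ p) (by fun_prop)
  have h2 := integral_pi_four τ (fun x y z w => |x - y| ^ p * |z - w| ^ p)
    (integrable_abs_sub_rpow_mul hp hmom 0 1 2 3)
  refine (h.trans h2).trans ?_
  simp only [integral_const_mul, integral_mul_const, meanDist, sq]

end Moments

/-! ### The covariance matrix -/

section Covariance

variable {τ : Measure ℝ} {p : ℝ}

/-- The centred `p`-th powers of the coordinate distances of `M` nodes. -/
def centredDist (τ : Measure ℝ) (p : ℝ) {M : ℕ} (e : Pairs M) (y : Fin M → ℝ) : ℝ :=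
  |y e.1.1 - y e.1.2| ^ p - meanDist τ p

@[fun_prop]
lemma measurable_centredDist {M : ℕ} (e : Pairs M) : Measurable (centredDist τ p e) := by
  unfold centredDist; fun_prop

lemma memLp_centredDist [IsProbabilityMeasure τ] (hp : 0 < p)
    (hmom : Integrable (fun t : ℝ => |t| ^ (2 * p)) τ) {M : ℕ} (e : Pairs M) :
    MemLp (centredDist τ p e) 2 (Measure.pi fun _ => τ) :=
  (memLp_abs_sub_rpow hp hmom e.1.1 e.1.2).sub (memLp_const _)

lemma integral_centredDist [IsProbabilityMeasure τ] (hp : 0 < p)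
    (hmom : Integrable (fun t : ℝ => |t| ^ (2 * p)) τ) {M : ℕ} (e : Pairs M) :
    ∫ y, centredDist τ p e y ∂(Measure.pi fun _ => τ) = 0 := by
  unfold centredDist
  rw [integral_sub (integrable_abs_sub_rpow hp hmom _ _) (integrable_const _),
    integral_abs_sub_rpow hp hmom e.2.ne]
  simp

lemma covMatrix_eq_integral_sub [IsProbabilityMeasure τ] (hp : 0 < p)
    (hmom : Integrable (fun t : ℝ => |t| ^ (2 * p)) τ) {M : ℕ} (e f : Pairs M) :
    covMatrix τ p M e f = (∫ y : Fin M → ℝ, |y e.1.1 - y e.1.2| ^ p * |y f.1.1 - y f.1.2| ^ p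
      ∂(Measure.pi fun _ => τ)) - meanDist τ p ^ 2 := by
  have i1 := integrable_abs_sub_rpow_mul hp hmom e.1.1 e.1.2 f.1.1 f.1.2
  have i2 := integrable_abs_sub_rpow hp hmom e.1.1 e.1.2
  have i3 := integrable_abs_sub_rpow hp hmom f.1.1 f.1.2
  have m2 := integral_abs_sub_rpow hp hmom e.2.ne
  have m3 := integral_abs_sub_rpow hp hmom f.2.ne
  unfold covMatrix
  have : ∀ y : Fin M → ℝ, (|y e.1.1 - y e.1.2| ^ p - meanDist τ p) *
      (|y f.1.1 - y f.1.2| ^ p - meanDist τ p) =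
      |y e.1.1 - y e.1.2| ^ p * |y f.1.1 - y f.1.2| ^ p - meanDist τ p * |y e.1.1 - y e.1.2| ^ p -
        meanDist τ p * |y f.1.1 - y f.1.2| ^ p + meanDist τ p ^ 2 := fun y => by ring
  simp only [this]
  rw [integral_add, integral_sub, integral_sub, integral_const_mul, integral_const_mul, m2, m3]
  · simp; ring
  · exact i1
  · exact i2.const_mul _
  · exact i1.sub (i2.const_mul _)
  · exact i3.const_mul _
  · exact (i1.sub (i2.const_mul _)).sub (i3.const_mul _)
  · exact integrable_const _

theorem covMatrix_eq [IsProbabilityMeasure τ] (hp : 0 < p)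
    (hmom : Integrable (fun t : ℝ => |t| ^ (2 * p)) τ) (M : ℕ) :
    covMatrix τ p M = diagCorr τ p • (1 : Matrix (Pairs M) (Pairs M) ℝ) +
      triCorr τ p • (johnsonGraph M).adjMatrix ℝ := by
  ext e f
  rw [covMatrix_eq_integral_sub hp hmom, Matrix.add_apply, Matrix.smul_apply, Matrix.smul_apply,
    SimpleGraph.adjMatrix_apply]
  by_cases hef : e = f
  · subst hef
    rw [integral_abs_sub_rpow_two_mul hp hmom e.2.ne]
    simp
  rw [Matrix.one_apply_ne hef]
  obtain ⟨⟨i, j⟩, hij⟩ := e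
  obtain ⟨⟨k, l⟩, hkl⟩ := f
  simp only at hij hkl
  have hne : i = k → j ≠ l := by rintro rfl rfl; exact hef rfl
  simp only [johnsonGraph]
  by_cases h1 : i = k
  · subst h1
    rw [integral_abs_sub_rpow_mul_share hp hmom hij.ne hkl.ne (hne rfl)]
    simp [hne rfl]
  by_cases h2 : i = l
  · subst h2
    have : ∀ y : Fin M → ℝ, |y k - y i| = |y i - y k| := fun y => abs_sub_comm _ _
    simp only [this]
    rw [integral_abs_sub_rpow_mul_share hp hmom hij.ne h1 (by omega)]
    simp [h1]
  by_cases h3 : j = k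
  · subst h3
    have : ∀ y : Fin M → ℝ, |y i - y j| = |y j - y i| := fun y => abs_sub_comm _ _
    simp only [this]
    rw [integral_abs_sub_rpow_mul_share hp hmom hij.ne' hkl.ne h2]
    simp [h1]
  by_cases h4 : j = l
  · subst h4
    have : ∀ y : Fin M → ℝ, ∀ i, |y i - y j| = |y j - y i| := fun y i => abs_sub_comm _ _
    simp only [this]
    rw [integral_abs_sub_rpow_mul_share hp hmom hij.ne' hkl.ne' h1]
    simp [h1]
  rw [integral_abs_sub_rpow_mul_disjoint hp hmom hij.ne h1 h2 h3 h4 hkl.ne]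
  simp [h1, h2, h3, h4]

/-- The incidence matrix of nodes and pairs. -/
def incidence (M : ℕ) : Matrix (Fin M) (Pairs M) ℝ := fun v e =>
  if v = e.1.1 ∨ v = e.1.2 then 1 else 0

lemma sum_incidence_mul {M : ℕ} (e : Pairs M) (w : Fin M → ℝ) :
    ∑ v, incidence M v e * w v = w e.1.1 + w e.1.2 := by
  have : ∀ v, incidence M v e * w v =
      (if v = e.1.1 then w v else 0) + (if v = e.1.2 then w v else 0) := by
    intro v
    have := e.2.ne
    unfold incidence
    by_cases h1 : v = e.1.1 <;> by_cases h2 : v = e.1.2 <;> simp_all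
  simp [this, Finset.sum_add_distrib]

lemma adjMatrix_johnsonGraph (M : ℕ) : (johnsonGraph M).adjMatrix ℝ =
    (incidence M).transpose * incidence M - (2 : ℝ) • 1 := by
  ext ⟨⟨i, j⟩, hij⟩ ⟨⟨k, l⟩, hkl⟩
  rw [Matrix.sub_apply, Matrix.mul_apply, SimpleGraph.adjMatrix_apply]
  simp only [Matrix.transpose_apply]
  rw [sum_incidence_mul ⟨(i, j), hij⟩]
  simp only [johnsonGraph, incidence, Matrix.smul_apply, Matrix.one_apply, smul_eq_mul,
    Subtype.mk.injEq, Prod.mk.injEq, ne_eq]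
  simp only at hij hkl
  by_cases h1 : i = k <;> by_cases h2 : i = l <;> by_cases h3 : j = k <;> by_cases h4 : j = l <;>
    simp [h1, h2, h3, h4] <;> first | omega | norm_num

lemma covMatrix_eq_incidence [IsProbabilityMeasure τ] (hp : 0 < p)
    (hmom : Integrable (fun t : ℝ => |t| ^ (2 * p)) τ) (M : ℕ) :
    covMatrix τ p M = (diagCorr τ p - 2 * triCorr τ p) • (1 : Matrix (Pairs M) (Pairs M) ℝ) +
      triCorr τ p • ((incidence M).transpose * incidence M) := by
  rw [covMatrix_eq hp hmom, adjMatrix_johnsonGraph]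
  module

lemma dotProduct_covMatrix_mulVec [IsProbabilityMeasure τ] (hp : 0 < p)
    (hmom : Integrable (fun t : ℝ => |t| ^ (2 * p)) τ) {M : ℕ} (q : Pairs M → ℝ) :
    q ⬝ᵥ (covMatrix τ p M).mulVec q =
      ∫ y, (∑ e, q e * centredDist τ p e y) ^ 2 ∂(Measure.pi fun _ => τ) := by
  have hi : ∀ e f : Pairs M, Integrable (fun y => centredDist τ p e y * centredDist τ p f y)
      (Measure.pi fun _ => τ) := fun e f =>
    (memLp_centredDist hp hmom e).integrable_mul (memLp_centredDist hp hmom f)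
  have e1 : ∀ y : Fin M → ℝ, (∑ e, q e * centredDist τ p e y) ^ 2 =
      ∑ e, ∑ f, q e * q f * (centredDist τ p e y * centredDist τ p f y) := by
    intro y
    rw [sq, Finset.sum_mul_sum]
    exact Finset.sum_congr rfl fun e _ => Finset.sum_congr rfl fun f _ => by ring
  simp only [e1]
  rw [integral_finsetSum _ fun e _ => integrable_finsetSum _ fun f _ => (hi e f).const_mul _]
  simp only [dotProduct, Matrix.mulVec, Finset.mul_sum]
  refine Finset.sum_congr rfl fun e _ => ?_
  rw [integral_finsetSum _ fun f _ => (hi e f).const_mul _]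
  refine Finset.sum_congr rfl fun f _ => ?_
  rw [integral_const_mul]
  simp only [covMatrix, centredDist]
  ring

lemma exists_ne_mem_support [IsProbabilityMeasure τ] (hτ : ∀ a : ℝ, τ ≠ Measure.dirac a) :
    ∃ a ∈ τ.support, ∃ b ∈ τ.support, a ≠ b := by
  obtain ⟨a, ha⟩ := Measure.nonempty_support (IsProbabilityMeasure.ne_zero τ)
  by_contra! h
  refine hτ a ?_
  have h0 : ∀ᵐ x ∂τ, x = a := by
    filter_upwards [Measure.support_mem_ae (μ := τ)] with x hx using (h a ha x hx).symm
  ext s hs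
  rw [Measure.dirac_apply' _ hs]
  by_cases has : a ∈ s
  · have : s ∈ ae τ := by filter_upwards [h0] with x hx; rwa [hx]
    rw [prob_compl_eq_zero_iff hs |>.1 this]; simp [has]
  · have : sᶜ ∈ ae τ := by filter_upwards [h0] with x hx; rwa [hx]
    rw [mem_ae_iff, compl_compl] at this
    simp [this, has]

lemma pi_pos_of_isOpen {ι : Type*} [Fintype ι] [IsProbabilityMeasure τ] {U : Set (ι → ℝ)}
    (hU : IsOpen U) {y : ι → ℝ} (hy : y ∈ U) (hs : ∀ i, y i ∈ τ.support) :
    0 < Measure.pi (fun _ : ι => τ) U := by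
  obtain ⟨u, hu, huU⟩ := isOpen_pi_iff'.1 hU y hy
  refine lt_of_lt_of_le ?_ (measure_mono huU)
  rw [Measure.pi_pi]
  refine pos_iff_ne_zero.2 (Finset.prod_ne_zero_iff.2 fun i _ => ne_of_gt ?_)
  exact (Measure.mem_support_iff_forall _).1 (hs i) _ ((hu i).1.mem_nhds (hu i).2)

lemma two_mul_triCorr_lt_diagCorr [IsProbabilityMeasure τ] (hp : 0 < p)
    (hmom : Integrable (fun t : ℝ => |t| ^ (2 * p)) τ) (hτ : ∀ a : ℝ, τ ≠ Measure.dirac a) :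
    2 * triCorr τ p < diagCorr τ p := by
  let qz : Pairs 4 → ℤ := fun e => if e.1 = (0, 1) ∨ e.1 = (2, 3) then 1 else
    if e.1 = (0, 2) ∨ e.1 = (1, 3) then -1 else 0
  let q : Pairs 4 → ℝ := fun e => qz e
  have hz : ∀ v : Fin 4, ∑ e : Pairs 4, (if v = e.1.1 ∨ v = e.1.2 then 1 else 0) * qz e = 0 := by
    decide
  have hz2 : ∑ e : Pairs 4, qz e * qz e = 4 := by decide
  have hB : (incidence 4).mulVec q = 0 := by
    ext v
    have := congrArg (Int.cast : ℤ → ℝ) (hz v)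
    simpa [Matrix.mulVec, dotProduct, incidence, q] using this
  have hq : q ⬝ᵥ q = 4 := by
    have := congrArg (Int.cast : ℤ → ℝ) hz2
    push_cast at this
    exact this
  have h := dotProduct_covMatrix_mulVec (τ := τ) hp hmom q
  rw [covMatrix_eq_incidence hp hmom, Matrix.add_mulVec, Matrix.smul_mulVec, Matrix.smul_mulVec,
    ← Matrix.mulVec_mulVec, hB, Matrix.mulVec_zero, Matrix.one_mulVec, smul_zero, add_zero,
    dotProduct_smul, hq, smul_eq_mul] at h
  set F : (Fin 4 → ℝ) → ℝ := fun y => ∑ e, q e * centredDist τ p e y with hF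
  have hFe : ∀ y, F y = |y 0 - y 1| ^ p + |y 2 - y 3| ^ p - |y 0 - y 2| ^ p - |y 1 - y 3| ^ p := by
    intro y
    have hu : (Finset.univ : Finset (Pairs 4)) = {⟨(0, 1), by decide⟩, ⟨(0, 2), by decide⟩,
        ⟨(0, 3), by decide⟩, ⟨(1, 2), by decide⟩, ⟨(1, 3), by decide⟩, ⟨(2, 3), by decide⟩} := by
      decide
    simp only [hF, hu]
    repeat rw [Finset.sum_insert (by decide)]
    rw [Finset.sum_singleton]
    simp [q, qz, centredDist]
    ring
  have hFc : Continuous F := by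
    have : F = fun y => |y 0 - y 1| ^ p + |y 2 - y 3| ^ p - |y 0 - y 2| ^ p - |y 1 - y 3| ^ p :=
      funext hFe
    rw [this]
    have hc : ∀ i j : Fin 4, Continuous fun y : Fin 4 → ℝ => |y i - y j| ^ p := fun i j =>
      (by fun_prop : Continuous fun y : Fin 4 → ℝ => |y i - y j|).rpow_const
        fun _ => Or.inr hp.le
    exact (((hc _ _).add (hc _ _)).sub (hc _ _)).sub (hc _ _)
  obtain ⟨a, ha, b, hb, hab⟩ := exists_ne_mem_support hτ
  have hpos : 0 < ∫ y, F y ^ 2 ∂(Measure.pi fun _ => τ) := by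
    have hint : Integrable (fun y => F y ^ 2) (Measure.pi fun _ => τ) := by
      have : MemLp F 2 (Measure.pi fun _ => τ) :=
        memLp_finsetSum _ fun e _ => (memLp_centredDist hp hmom e).const_mul _
      exact this.integrable_sq
    rw [integral_pos_iff_support_of_nonneg (fun y => sq_nonneg _) hint]
    have hU : IsOpen (Function.support fun y => F y ^ 2) :=
      (hFc.pow 2).isOpen_support
    refine pi_pos_of_isOpen hU (y := ![a, b, a, b]) ?_ ?_
    · have hd : 0 < |a - b| ^ p := Real.rpow_pos_of_pos (abs_pos.2 (sub_ne_zero.2 hab)) p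
      rw [Function.mem_support, hFe]
      simp [Real.zero_rpow hp.ne']
      linarith
    · intro i; fin_cases i <;> assumption
  linarith

lemma memLp_integral_abs_sub_rpow [IsProbabilityMeasure τ] (hp : 0 < p)
    (hmom : Integrable (fun t : ℝ => |t| ^ (2 * p)) τ) :
    MemLp (fun x => ∫ y, |x - y| ^ p ∂τ) 2 τ := by
  have hm : StronglyMeasurable fun x => ∫ y, |x - y| ^ p ∂τ := by
    refine StronglyMeasurable.integral_prod_right (f := fun x y => |x - y| ^ p) ?_
    exact Measurable.stronglyMeasurable (by unfold Function.uncurry; fun_prop)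
  rw [memLp_two_iff_integrable_sq hm.aestronglyMeasurable]
  have h1 := (integral_pi_succ τ _ (integrable_abs_sub_rpow_mul hp hmom
    (0 : Fin 3) 1 0 2)).1
  refine h1.integral_prod_left.congr ?_
  filter_upwards [h1.prod_right_ae] with x hx
  refine (integral_pi_two τ (fun y z => |x - y| ^ p * |x - z| ^ p) hx).trans ?_
  simp only [integral_const_mul, integral_mul_const, sq]

lemma triCorr_eq_variance [IsProbabilityMeasure τ] (hp : 0 < p)
    (hmom : Integrable (fun t : ℝ => |t| ^ (2 * p)) τ) :
    triCorr τ p = Var[fun x => ∫ y, |x - y| ^ p ∂τ; τ] := by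
  rw [variance_eq_sub (memLp_integral_abs_sub_rpow hp hmom)]
  simp only [triCorr, meanDist, integral_const_mul, integral_mul_const, sq, Pi.mul_apply]

lemma triCorr_nonneg [IsProbabilityMeasure τ] (hp : 0 < p)
    (hmom : Integrable (fun t : ℝ => |t| ^ (2 * p)) τ) : 0 ≤ triCorr τ p := by
  rw [triCorr_eq_variance hp hmom]
  exact variance_nonneg _ _

theorem diagCorr_pos [IsProbabilityMeasure τ] (hp : 0 < p)
    (hmom : Integrable (fun t : ℝ => |t| ^ (2 * p)) τ) (hτ : ∀ a : ℝ, τ ≠ Measure.dirac a) :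
    0 < diagCorr τ p := by
  linarith [two_mul_triCorr_lt_diagCorr hp hmom hτ, triCorr_nonneg hp hmom]

theorem posDef_covMatrix [IsProbabilityMeasure τ] (hp : 0 < p)
    (hmom : Integrable (fun t : ℝ => |t| ^ (2 * p)) τ) (hτ : ∀ a : ℝ, τ ≠ Measure.dirac a)
    (M : ℕ) : (covMatrix τ p M).PosDef := by
  rw [covMatrix_eq_incidence hp hmom]
  have h1 := two_mul_triCorr_lt_diagCorr hp hmom hτ
  refine (Matrix.PosDef.one.smul (by linarith)).add_posSemidef ?_
  refine Matrix.PosSemidef.smul ?_ (triCorr_nonneg hp hmom)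
  have := Matrix.posSemidef_conjTranspose_mul_self (incidence M)
  rwa [Matrix.conjTranspose_eq_transpose_of_trivial] at this

/-! ### The uniform law -/

lemma integral_unitInterval_abs_sub_rpow (hp : 0 < p) {x : ℝ} (hx : x ∈ Set.Icc (0 : ℝ) 1) :
    ∫ y in Set.Icc (0 : ℝ) 1, |x - y| ^ p = (x ^ (p + 1) + (1 - x) ^ (p + 1)) / (p + 1) := by
  have hc : Continuous fun y : ℝ => |x - y| ^ p :=
    (by fun_prop : Continuous fun y : ℝ => |x - y|).rpow_const fun _ => Or.inr hp.le
  rw [integral_Icc_eq_integral_Ioc, ← intervalIntegral.integral_of_le zero_le_one,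
    ← intervalIntegral.integral_add_adjacent_intervals (b := x)
      (hc.intervalIntegrable _ _) (hc.intervalIntegrable _ _)]
  have h1 : ∫ y in (0 : ℝ)..x, |x - y| ^ p = x ^ (p + 1) / (p + 1) := by
    rw [intervalIntegral.integral_comp_sub_left (fun t => |t| ^ p) x, sub_self, sub_zero]
    rw [intervalIntegral.integral_congr (g := fun t => t ^ p), integral_rpow (Or.inl (by linarith)),
      Real.zero_rpow (by linarith), sub_zero]
    intro t ht
    rw [Set.uIcc_of_le hx.1] at ht
    simp only [abs_of_nonneg ht.1]
  have h2 : ∫ y in x..1, |x - y| ^ p = (1 - x) ^ (p + 1) / (p + 1) := by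
    have : ∀ y : ℝ, |x - y| = |y - x| := fun y => abs_sub_comm _ _
    simp only [this]
    rw [intervalIntegral.integral_comp_sub_right (fun t => |t| ^ p) x, sub_self]
    rw [intervalIntegral.integral_congr (g := fun t => t ^ p), integral_rpow (Or.inl (by linarith)),
      Real.zero_rpow (by linarith), sub_zero]
    intro t ht
    rw [Set.uIcc_of_le (sub_nonneg.2 hx.2)] at ht
    simp only [abs_of_nonneg ht.1]
  rw [h1, h2, add_div]

theorem triCorr_uniform_ne_zero (hp : 0 < p) :
    triCorr (volume.restrict (Set.Icc (0 : ℝ) 1)) p ≠ 0 := by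
  intro h0
  have : IsProbabilityMeasure (volume.restrict (Set.Icc (0 : ℝ) 1)) := ⟨by simp⟩
  have hmom : Integrable (fun t : ℝ => |t| ^ (2 * p)) (volume.restrict (Set.Icc (0 : ℝ) 1)) :=
    (continuous_abs.rpow_const fun _ => Or.inr (by positivity)).continuousOn.integrableOn_Icc
  rw [triCorr_eq_variance hp hmom] at h0
  have hae := ae_eq_integral_of_variance_eq_zero (memLp_integral_abs_sub_rpow hp hmom) h0
  set c := ∫ x in Set.Icc (0 : ℝ) 1, ∫ y in Set.Icc (0 : ℝ) 1, |x - y| ^ p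
  have hEq : Set.EqOn (fun x : ℝ => (x ^ (p + 1) + (1 - x) ^ (p + 1)) / (p + 1)) (fun _ => c)
      (Set.Icc 0 1) := by
    refine Measure.eqOn_Icc_of_ae_eq volume zero_ne_one ?_ ?_ continuousOn_const
    · filter_upwards [hae, ae_restrict_mem measurableSet_Icc] with x hx hx'
      rw [← hx, integral_unitInterval_abs_sub_rpow hp hx']
    · have h1 : Continuous fun x : ℝ => x ^ (p + 1) :=
        continuous_id.rpow_const fun _ => Or.inr (by positivity)
      have h2 : Continuous fun x : ℝ => (1 - x) ^ (p + 1) :=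
        (continuous_const.sub continuous_id).rpow_const fun _ => Or.inr (by positivity)
      exact ((h1.add h2).div_const _).continuousOn
  have e1 := hEq (Set.left_mem_Icc.2 zero_le_one)
  have e2 := hEq (show (1 / 2 : ℝ) ∈ Set.Icc (0 : ℝ) 1 by norm_num)
  simp only at e1 e2
  rw [← e2, div_left_inj' (by positivity), Real.zero_rpow (by positivity), sub_zero,
    Real.one_rpow, show (1 : ℝ) - 1 / 2 = 1 / 2 by norm_num, Real.rpow_add (by norm_num),
    Real.rpow_one] at e1
  have h3 : (1 / 2 : ℝ) ^ p < 1 := Real.rpow_lt_one (by norm_num) (by norm_num) hp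
  linarith

end Covariance

/-! ### Gaussian densities -/

section Gaussian

/-- The vectors all of whose coordinates are at most `x`. -/
def orthant (ι : Type*) (x : ℝ) : Set (EuclideanSpace ℝ ι) := {q | ∀ i, q i ≤ x}

lemma isClosed_orthant (ι : Type*) (x : ℝ) : IsClosed (orthant ι x) := by
  simp only [orthant, Set.ofPred_forall]
  exact isClosed_iInter fun i => isClosed_le (by fun_prop) continuous_const

variable {ι : Type*} [Fintype ι]

lemma pi_gaussianReal_eq_withDensity :
    Measure.pi (fun _ : ι => gaussianReal 0 1) =
      volume.withDensity fun z : ι → ℝ => ENNReal.ofReal (∏ i, gaussianPDFReal 0 1 (z i)) := by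
  have hint : ∀ s : ι → Set ℝ, Integrable (fun z : ι → ℝ => ∏ i, gaussianPDFReal 0 1 (z i))
      (Measure.pi fun i => volume.restrict (s i)) := fun s =>
    Integrable.fintype_prod fun i => (integrable_gaussianPDFReal 0 1).restrict
  refine (Measure.pi_eq fun s hs => ?_)
  rw [withDensity_apply _ (MeasurableSet.univ_pi hs), volume_pi, Measure.restrict_pi_pi,
    ← ofReal_integral_eq_lintegral_ofReal (hint s)
      (ae_of_all _ fun z => Finset.prod_nonneg fun i _ => gaussianPDFReal_nonneg _ _ _),
    integral_fintype_prod_eq_prod,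
    ENNReal.ofReal_prod_of_nonneg fun i _ => integral_nonneg fun z => gaussianPDFReal_nonneg _ _ _]
  exact Finset.prod_congr rfl fun i _ => (gaussianReal_apply_eq_integral 0 one_ne_zero _).symm

lemma prod_gaussianPDFReal (z : ι → ℝ) : ∏ i, gaussianPDFReal 0 1 (z i) =
    Real.exp (-(1 / 2) * (z ⬝ᵥ z)) / Real.sqrt ((2 * Real.pi) ^ Fintype.card ι) := by
  simp only [gaussianPDFReal, NNReal.coe_one, mul_one, sub_zero]
  rw [Finset.prod_mul_distrib, ← Real.exp_sum, Finset.prod_const, Finset.card_univ, inv_pow,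
    Real.sqrt_eq_rpow, Real.sqrt_eq_rpow, ← Real.rpow_natCast_mul (by positivity),
    ← Real.rpow_mul_natCast (by positivity), mul_comm (Fintype.card ι : ℝ), mul_comm,
    ← div_eq_mul_inv]
  congr 2
  rw [dotProduct, Finset.mul_sum]
  exact Finset.sum_congr rfl fun i _ => by ring

lemma gaussianDensity_mul_transpose [DecidableEq ι] (A : Matrix ι ι ℝ) (hA : A.det ≠ 0) (z : ι → ℝ) :
    gaussianDensity (A * A.transpose) (A.mulVec z) * |A.det| =
      ∏ i, gaussianPDFReal 0 1 (z i) := by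
  have hu : IsUnit A.det := hA.isUnit
  rw [prod_gaussianPDFReal, gaussianDensity, Matrix.mul_inv_rev, Matrix.mulVec_mulVec,
    Matrix.mul_assoc, Matrix.nonsing_inv_mul _ hu, Matrix.mul_one, ← Matrix.transpose_nonsing_inv,
    Matrix.mulVec_transpose, dotProduct_comm, ← Matrix.dotProduct_mulVec,
    Matrix.mulVec_mulVec, Matrix.nonsing_inv_mul _ hu, Matrix.one_mulVec, Matrix.det_mul,
    Matrix.det_transpose, Real.sqrt_mul (by positivity), Real.sqrt_mul_self_eq_abs]
  have : |A.det| ≠ 0 := abs_ne_zero.2 hA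
  field_simp

lemma integral_multivariateGaussian [DecidableEq ι] {S : Matrix ι ι ℝ} (hS : S.PosDef) {g : (ι → ℝ) → ℝ}
    (hg : Measurable g) :
    ∫ q, g (WithLp.ofLp q) ∂(multivariateGaussian 0 S) = ∫ q, gaussianDensity S q * g q := by
  open scoped MatrixOrder in
  obtain ⟨A, hAS, hsymm, hmul⟩ : ∃ A : Matrix ι ι ℝ, A = CFC.sqrt S ∧ A.transpose = A ∧
      A * A = S := by
    refine ⟨CFC.sqrt S, rfl, ?_, CFC.sqrt_mul_sqrt_self _ hS.posSemidef.nonneg⟩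
    have := (CFC.sqrt_nonneg S).isSelfAdjoint
    rwa [isSelfAdjoint_iff, Matrix.star_eq_conjTranspose,
      Matrix.conjTranspose_eq_transpose_of_trivial] at this
  have hdet : A.det ≠ 0 := by
    intro h0
    have := hS.det_pos
    rw [← hmul, Matrix.det_mul, h0] at this
    simp at this
  have hdens : ∀ z : ι → ℝ, gaussianDensity S (A.mulVec z) * |A.det| =
      ∏ i, gaussianPDFReal 0 1 (z i) := by
    intro z
    rw [← gaussianDensity_mul_transpose A hdet, hsymm, hmul]
  have hmeas : Measurable (gaussianDensity S) := by
    unfold gaussianDensity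
    have : Continuous fun q : ι → ℝ => q ⬝ᵥ S⁻¹.mulVec q := by fun_prop
    exact ((this.measurable.const_mul _).exp).div_const _
  have hlin : Measurable fun z : ι → ℝ => A.mulVec z :=
    (by fun_prop : Continuous fun z : ι → ℝ => A.mulVec z).measurable
  have hgo : Measurable fun q : EuclideanSpace ℝ ι => g (WithLp.ofLp q) :=
    hg.comp (PiLp.continuous_ofLp 2 _).measurable
  rw [multivariateGaussian, ← map_pi_eq_stdGaussian, ← hAS,
    Measure.map_map (by fun_prop) (by fun_prop),
    integral_map (by fun_prop) hgo.aestronglyMeasurable]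
  have e1 : ∀ z : ι → ℝ, WithLp.ofLp (((fun x => (0 : EuclideanSpace ℝ ι) +
      Matrix.toEuclideanCLM (𝕜 := ℝ) A x) ∘ WithLp.toLp 2) z) = A.mulVec z := by
    intro z; simp
  simp only [e1]
  rw [pi_gaussianReal_eq_withDensity, integral_withDensity_eq_integral_toReal_smul
    (by fun_prop) (ae_of_all _ fun _ => ENNReal.ofReal_lt_top)]
  have e2 : ∀ z : ι → ℝ, (ENNReal.ofReal (∏ i, gaussianPDFReal 0 1 (z i))).toReal •
      g (A.mulVec z) = |A.det| * (gaussianDensity S (A.mulVec z) * g (A.mulVec z)) := by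
    intro z
    rw [ENNReal.toReal_ofReal (Finset.prod_nonneg fun i _ => gaussianPDFReal_nonneg _ _ _),
      ← hdens, smul_eq_mul]
    ring
  simp only [e2]
  rw [integral_const_mul]
  have h := Real.map_matrix_volume_pi_eq_smul_volume_pi hdet
  have h2 := integral_map (μ := (volume : Measure (ι → ℝ))) (φ := Matrix.toLin' A)
    (f := fun q => gaussianDensity S q * g q) hlin.aemeasurable
    (hmeas.mul hg).aestronglyMeasurable
  rw [h, integral_smul_measure, ENNReal.toReal_ofReal (abs_nonneg _)] at h2
  simp only [Matrix.toLin'_apply] at h2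
  rw [← h2, smul_eq_mul, abs_inv, mul_inv_cancel_left₀ (abs_ne_zero.2 hdet)]

lemma frontier_orthant_subset (x : ℝ) :
    frontier (orthant ι x) ⊆ ⋃ i, {q : EuclideanSpace ℝ ι | q i = x} := by
  have hU : IsOpen {q : EuclideanSpace ℝ ι | ∀ i, q i < x} := by
    simp only [Set.ofPred_forall]
    exact isOpen_iInter_of_finite fun i => isOpen_lt (by fun_prop) continuous_const
  have hsub : {q : EuclideanSpace ℝ ι | ∀ i, q i < x} ⊆ interior (orthant ι x) :=
    interior_maximal (fun q hq i => (hq i).le) hU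
  intro q hq
  rw [(isClosed_orthant ι x).frontier_eq] at hq
  by_contra h
  simp only [Set.mem_iUnion, Set.mem_ofPred_eq, not_exists] at h
  exact hq.2 (hsub fun i => lt_of_le_of_ne (hq.1 i) (h i))

lemma multivariateGaussian_frontier_orthant [DecidableEq ι] {S : Matrix ι ι ℝ} (hS : S.PosDef) (x : ℝ) :
    multivariateGaussian 0 S (frontier (orthant ι x)) = 0 := by
  refine measure_mono_null (frontier_orthant_subset x) (measure_iUnion_null fun i => ?_)
  have h := measurePreserving_eval_multivariateGaussian (μ := 0) hS.posSemidef (i := i)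
  have : {q : EuclideanSpace ℝ ι | q i = x} = (fun q => q i) ⁻¹' {x} := rfl
  rw [this, h.measure_preimage (measurableSet_singleton x).nullMeasurableSet]
  have hv : (S i i).toNNReal ≠ 0 := by simpa using hS.diag_pos
  have := nullSingletonClass_gaussianReal (μ := (0 : EuclideanSpace ℝ ι) i) hv
  exact measure_singleton x

theorem multivariateGaussian_orthant [DecidableEq ι] {S : Matrix ι ι ℝ} (hS : S.PosDef) (x : ℝ) :
    (multivariateGaussian 0 S).real (orthant ι x) =
      ∫ q : ι → ℝ, gaussianDensity S q * ∏ i, heaviside (x - q i) := by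
  have hh : Measurable heaviside :=
    Measurable.ite (measurableSet_le measurable_const measurable_id) measurable_const
      measurable_const
  rw [← integral_multivariateGaussian hS (g := fun q => ∏ i, heaviside (x - q i)) (by fun_prop),
    ← integral_indicator_one (isClosed_orthant ι x).measurableSet]
  refine integral_congr_ae (ae_of_all _ fun q => ?_)
  by_cases hq : q ∈ orthant ι x
  · simp only [Set.indicator_of_mem hq, Pi.one_apply, heaviside, sub_nonneg]
    exact (Finset.prod_eq_one fun i _ => if_pos (hq i)).symm
  · simp only [Set.indicator_of_notMem hq, heaviside, sub_nonneg]
    simp only [orthant, Set.mem_ofPred_eq, not_forall] at hq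
    obtain ⟨i, hi⟩ := hq
    exact (Finset.prod_eq_zero (Finset.mem_univ i) (if_neg hi)).symm

end Gaussian

section Limit

variable {τ : Measure ℝ} {p : ℝ}

theorem limitDensity_eq [IsProbabilityMeasure τ] (hp : 0 < p)
    (hmom : Integrable (fun t : ℝ => |t| ^ (2 * p)) τ) (hτ : ∀ a : ℝ, τ ≠ Measure.dirac a)
    (M : ℕ) (x : ℝ) : limitDensity τ p M x =
      (multivariateGaussian 0 (covMatrix τ p M)).real (orthant (Pairs M) x) :=
  (multivariateGaussian_orthant (posDef_covMatrix hp hmom hτ M) x).symm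

instance : Unique (Pairs 2) where
  default := ⟨(0, 1), by decide⟩
  uniq := by decide

lemma covMatrix_diag [IsProbabilityMeasure τ] (hp : 0 < p)
    (hmom : Integrable (fun t : ℝ => |t| ^ (2 * p)) τ) {M : ℕ} (e : Pairs M) :
    covMatrix τ p M e e = diagCorr τ p := by
  simp [covMatrix_eq hp hmom]

theorem limitDensity_two_eq_gaussianReal [IsProbabilityMeasure τ] (hp : 0 < p)
    (hmom : Integrable (fun t : ℝ => |t| ^ (2 * p)) τ) (hτ : ∀ a : ℝ, τ ≠ Measure.dirac a)
    (x : ℝ) : limitDensity τ p 2 x =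
      (gaussianReal 0 (diagCorr τ p).toNNReal).real (Set.Iic x) := by
  rw [limitDensity_eq hp hmom hτ]
  have h := measurePreserving_eval_multivariateGaussian (μ := 0)
    (posDef_covMatrix hp hmom hτ 2).posSemidef (i := default)
  rw [covMatrix_diag hp hmom] at h
  have e : orthant (Pairs 2) x = (fun q => q default) ⁻¹' Set.Iic x := by
    ext q
    simp [orthant, Unique.forall_iff]
  rw [e, measureReal_def, h.measure_preimage measurableSet_Iic.nullMeasurableSet]
  rfl

lemma gaussianReal_Iic {v : ℝ} (hv : 0 < v) (x : ℝ) :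
    (gaussianReal 0 v.toNNReal).real (Set.Iic x) =
      1 / 2 * (1 + erf (x / Real.sqrt (2 * v))) := by
  have hv' : v.toNNReal ≠ 0 := by simpa using hv
  set f := gaussianPDFReal 0 v.toNNReal with hf
  have hint : Integrable f := integrable_gaussianPDFReal 0 _
  have hreal : ∀ s, (gaussianReal 0 v.toNNReal).real s = ∫ t in s, f t := by
    intro s
    rw [measureReal_def, gaussianReal_apply_eq_integral 0 hv', ENNReal.toReal_ofReal]
    exact integral_nonneg fun t => gaussianPDFReal_nonneg _ _ _
  have hsymm : ∀ t, f (-t) = f t := by intro t; simp [hf, gaussianPDFReal]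
  have h0 : ∫ t in Set.Iic 0, f t = 1 / 2 := by
    have h1 : ∫ t in Set.Ioi 0, f t = ∫ t in Set.Iic 0, f t := by
      have := integral_comp_neg_Iic (0 : ℝ) f
      simp only [hsymm, neg_zero] at this
      exact this.symm
    have h2 := intervalIntegral.integral_Iic_add_Ioi (b := 0) (μ := volume) (f := f)
      hint.integrableOn hint.integrableOn
    rw [integral_gaussianPDFReal_eq_one 0 hv', h1] at h2
    linarith
  have h3 := intervalIntegral.integral_Iic_sub_Iic (μ := volume) (f := f) (a := 0) (b := x)
    hint.integrableOn hint.integrableOn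
  have hs : 0 < Real.sqrt (2 * v) := Real.sqrt_pos.2 (by positivity)
  have h4 : ∫ t in (0 : ℝ)..x, f t = 1 / 2 * erf (x / Real.sqrt (2 * v)) := by
    have e : ∀ t, f t = (Real.sqrt Real.pi)⁻¹ * (Real.sqrt (2 * v))⁻¹ *
        Real.exp (-(t / Real.sqrt (2 * v)) ^ 2) := by
      intro t
      simp only [hf, gaussianPDFReal, Real.coe_toNNReal v hv.le, sub_zero]
      rw [div_pow, Real.sq_sqrt (by positivity), ← mul_inv, ← Real.sqrt_mul Real.pi_pos.le]
      congr 2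
      · ring_nf
      · ring_nf
    simp only [e]
    rw [intervalIntegral.integral_const_mul,
      intervalIntegral.integral_comp_div (fun u => Real.exp (-u ^ 2)) hs.ne', zero_div, erf,
      smul_eq_mul]
    field_simp
  rw [hreal, ← sub_add_cancel (∫ t in Set.Iic x, f t) (∫ t in Set.Iic 0, f t), h3, h4, h0]
  ring

lemma continuous_erf : Continuous erf :=
  continuous_const.mul (intervalIntegral.continuous_primitive
    (fun a b => Continuous.intervalIntegrable (by fun_prop) a b) 0)

lemma strictMono_gaussianReal_Iic {v : ℝ} (hv : 0 < v) :
    StrictMono fun x => (gaussianReal 0 v.toNNReal).real (Set.Iic x) := by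
  intro a b hab
  have hv' : v.toNNReal ≠ 0 := by simpa using hv
  have h1 : (gaussianReal 0 v.toNNReal).real (Set.Iic b) =
      (gaussianReal 0 v.toNNReal).real (Set.Iic a) +
        (gaussianReal 0 v.toNNReal).real (Set.Ioc a b) := by
    rw [← measureReal_union (Set.Iic_disjoint_Ioc le_rfl) measurableSet_Ioc,
      Set.Iic_union_Ioc_eq_Iic hab.le]
  have h2 : 0 < (gaussianReal 0 v.toNNReal).real (Set.Ioc a b) := by
    refine ENNReal.toReal_pos (fun h => ?_) (measure_ne_top _ _)
    have := gaussianReal_absolutelyContinuous' 0 hv' h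
    simp at this
    linarith
  simp only [h1]
  linarith

theorem bijOn_limitDensity_two [IsProbabilityMeasure τ] (hp : 0 < p)
    (hmom : Integrable (fun t : ℝ => |t| ^ (2 * p)) τ) (hτ : ∀ a : ℝ, τ ≠ Measure.dirac a) :
    Set.BijOn (limitDensity τ p 2) Set.univ (Set.Ioo 0 1) := by
  have hα := diagCorr_pos hp hmom hτ
  set γ := gaussianReal 0 (diagCorr τ p).toNNReal
  have he : limitDensity τ p 2 = fun x => γ.real (Set.Iic x) :=
    funext (limitDensity_two_eq_gaussianReal hp hmom hτ)
  have hcdf : limitDensity τ p 2 = cdf γ := by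
    rw [he]; ext x; exact (cdf_eq_real γ x).symm
  have hmono : StrictMono (limitDensity τ p 2) := he ▸ strictMono_gaussianReal_Iic hα
  have hcont : Continuous (limitDensity τ p 2) := by
    rw [he]
    simp only [γ, gaussianReal_Iic hα]
    exact continuous_const.mul (continuous_const.add
      (continuous_erf.comp (continuous_id.div_const _)))
  have hbot := tendsto_cdf_atBot γ
  have htop := tendsto_cdf_atTop γ
  rw [← hcdf] at hbot htop
  refine ⟨fun x _ => ⟨?_, ?_⟩, hmono.injective.injOn, fun u hu => ?_⟩
  · refine lt_of_le_of_lt ?_ (hmono (sub_one_lt x))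
    rw [hcdf]; exact cdf_nonneg _ _
  · refine lt_of_lt_of_le (hmono (lt_add_one x)) ?_
    rw [hcdf]; exact cdf_le_one _ _
  · obtain ⟨a, ha⟩ := (hbot.eventually_lt_const hu.1).exists
    obtain ⟨b, hb⟩ := (htop.eventually_const_lt hu.2).exists
    obtain ⟨c, hc⟩ := mem_range_of_exists_le_of_exists_ge hcont ⟨a, ha.le⟩ ⟨b, hb.le⟩
    exact ⟨c, trivial, hc⟩

end Limit

/-! ### The multivariate central limit theorem -/

section CentralLimit

open Filter Topology
open scoped RealInnerProductSpace

variable {ι : Type*} [Fintype ι] [DecidableEq ι] {Ω : Type*} [MeasurableSpace Ω]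

lemma charFun_map_pi_inv_sqrt_smul_sum {ι : Type*} [Fintype ι] (P : Measure Ω) [IsProbabilityMeasure P]
    {V : Ω → EuclideanSpace ℝ ι} (hV : Measurable V) (d : ℕ) (t : EuclideanSpace ℝ ι) :
    charFun ((Measure.pi fun _ : Fin d => P).map fun ω => (√(d : ℝ))⁻¹ • ∑ k, V (ω k)) t =
      charFun (P.map fun ω => ⟪V ω, t⟫) (√(d : ℝ))⁻¹ ^ d := by
  have hm : Measurable fun ω : Fin d → Ω => (√(d : ℝ))⁻¹ • ∑ k, V (ω k) := by fun_prop
  rw [charFun_apply, integral_map hm.aemeasurable (by fun_prop), charFun_apply,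
    integral_map (by fun_prop) (by fun_prop)]
  have h := integral_fintype_prod_eq_pow (ι := Fin d) (μ := P)
    (fun ω : Ω => Complex.exp (⟪⟪V ω, t⟫, (√(d : ℝ))⁻¹⟫ * Complex.I))
  rw [Fintype.card_fin] at h
  rw [← h]
  refine integral_congr_ae (ae_of_all _ fun ω => ?_)
  simp only
  rw [← Complex.exp_sum, real_inner_smul_left, sum_inner, ← Finset.sum_mul]
  congr 2
  rw [← Complex.ofReal_sum, Finset.mul_sum]
  simp

lemma tendsto_charFun_inner (P : Measure Ω) [IsProbabilityMeasure P]
    {V : Ω → EuclideanSpace ℝ ι} (hV : Measurable V) {S : Matrix ι ι ℝ} (hS : S.PosDef)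
    (h0 : ∀ t, ∫ ω, ⟪V ω, t⟫ ∂P = 0)
    (h1 : ∀ t : EuclideanSpace ℝ ι, ∫ ω, ⟪V ω, t⟫ ^ 2 ∂P = t.ofLp ⬝ᵥ S.mulVec t.ofLp)
    (t : EuclideanSpace ℝ ι) :
    Tendsto (fun d : ℕ => charFun (P.map fun ω => ⟪V ω, t⟫) (√(d : ℝ))⁻¹ ^ d) atTop
      (𝓝 (charFun (multivariateGaussian 0 S) t)) := by
  rcases eq_or_ne t 0 with rfl | ht
  · simp [charFun_apply]
  have e2 : charFun (multivariateGaussian 0 S) t =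
      Complex.exp (-((t.ofLp ⬝ᵥ S.mulVec t.ofLp : ℝ) : ℂ) / 2) := by
    rw [charFun_multivariateGaussian hS.posSemidef]
    simp [neg_div]
  rw [e2]
  have hvpos : 0 < t.ofLp ⬝ᵥ S.mulVec t.ofLp := by
    have := hS.dotProduct_mulVec_pos (x := t.ofLp) (by simpa using ht)
    simpa using this
  have h1t := h1 t
  generalize t.ofLp ⬝ᵥ S.mulVec t.ofLp = v at hvpos h1t ⊢
  have hs : √v ≠ 0 := (Real.sqrt_pos.2 hvpos).ne'
  have h := tendsto_charFun_inv_sqrt_mul_pow (P := P) (X := fun ω => (√v)⁻¹ * ⟪V ω, t⟫)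
    (by fun_prop) (by rw [integral_const_mul, h0, mul_zero])
    (by
      simp only [Pi.pow_apply, mul_pow]
      rw [integral_const_mul, h1t, inv_pow, Real.sq_sqrt hvpos.le, inv_mul_cancel₀ hvpos.ne'])
    (√v)
  have e3 : ∀ d : ℕ, charFun (P.map fun ω => (√v)⁻¹ * ⟪V ω, t⟫) ((√(d : ℝ))⁻¹ * √v) =
      charFun (P.map fun ω => ⟪V ω, t⟫) (√(d : ℝ))⁻¹ := by
    intro d
    rw [charFun_map_mul_comp (by fun_prop)]
    congr 1
    field_simp
  simp only [e3] at h
  rwa [← Complex.ofReal_pow, Real.sq_sqrt hvpos.le] at h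

lemma tendsto_measureReal_of_tendsto_charFun {E : Type*} [NormedAddCommGroup E]
    [InnerProductSpace ℝ E] [FiniteDimensional ℝ E] [MeasurableSpace E] [BorelSpace E]
    {L : ℕ → Measure E} (hL : ∀ d, IsProbabilityMeasure (L d)) {ν : Measure E}
    [IsProbabilityMeasure ν]
    (h : ∀ t, Tendsto (fun d => charFun (L d) t) atTop (𝓝 (charFun ν t))) {A : Set E}
    (hA : ν (frontier A) = 0) : Tendsto (fun d => (L d).real A) atTop (𝓝 (ν.real A)) := by
  let L' : ℕ → ProbabilityMeasure E := fun d => ⟨L d, hL d⟩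
  let ν' : ProbabilityMeasure E := ⟨ν, inferInstance⟩
  have h1 : Tendsto L' atTop (𝓝 ν') :=
    ProbabilityMeasure.tendsto_iff_tendsto_charFun.2 h
  have h2 := ProbabilityMeasure.tendsto_measure_of_null_frontier_of_tendsto h1
    ((ProbabilityMeasure.null_iff_toMeasure_null _ _).2 hA)
  exact (NNReal.continuous_coe.tendsto _).comp h2

theorem tendsto_multivariateGaussian (P : Measure Ω) [IsProbabilityMeasure P]
    {V : Ω → EuclideanSpace ℝ ι} (hV : Measurable V) {S : Matrix ι ι ℝ} (hS : S.PosDef)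
    (h0 : ∀ t, ∫ ω, ⟪V ω, t⟫ ∂P = 0)
    (h1 : ∀ t : EuclideanSpace ℝ ι, ∫ ω, ⟪V ω, t⟫ ^ 2 ∂P = t.ofLp ⬝ᵥ S.mulVec t.ofLp)
    {A : Set (EuclideanSpace ℝ ι)} (hA : multivariateGaussian 0 S (frontier A) = 0) :
    Tendsto (fun d : ℕ => ((Measure.pi fun _ : Fin d => P).map
      fun ω => (√(d : ℝ))⁻¹ • ∑ k, V (ω k)).real A) atTop
      (𝓝 ((multivariateGaussian 0 S).real A)) := by
  have hm : ∀ d : ℕ, Measurable fun ω : Fin d → Ω => (√(d : ℝ))⁻¹ • ∑ k, V (ω k) :=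
    fun d => by fun_prop
  exact tendsto_measureReal_of_tendsto_charFun
    (fun d => Measure.isProbabilityMeasure_map (hm d).aemeasurable)
    (fun t => (tendsto_charFun_inner P hV hS h0 h1 t).congr fun d =>
      (charFun_map_pi_inv_sqrt_smul_sum P hV d t).symm) hA

end CentralLimit

/-! ### Clique probabilities -/

section Clique

open Filter Topology
open scoped RealInnerProductSpace

lemma pDist_le_iff {p r : ℝ} (hp : 0 < p) (hr : 0 ≤ r) {d : ℕ} (x y : Fin d → ℝ) :
    pDist p x y ≤ r ↔ ∑ k, |x k - y k| ^ p ≤ r ^ max 1 p := by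
  have hS : 0 ≤ ∑ k, |x k - y k| ^ p := Finset.sum_nonneg fun k _ => by positivity
  rw [pDist]
  rcases le_total 1 p with h | h
  · rw [min_eq_left h, max_eq_right h, Real.rpow_one, one_div,
      Real.rpow_inv_le_iff_of_pos hS hr hp]
  · rw [min_eq_right h, max_eq_left h, Real.rpow_one, ← Real.rpow_mul hS,
      one_div_mul_cancel hp.ne', Real.rpow_one]

variable {τ : Measure ℝ} {p : ℝ}

/-- The vector of centred `p`-th powers of the coordinate distances of `M` nodes. -/
def centredDistVec (τ : Measure ℝ) (p : ℝ) (M : ℕ) (y : Fin M → ℝ) : EuclideanSpace ℝ (Pairs M) :=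
  WithLp.toLp 2 fun e => centredDist τ p e y

@[fun_prop]
lemma measurable_centredDistVec (M : ℕ) : Measurable (centredDistVec τ p M) := by
  unfold centredDistVec; fun_prop

lemma inner_centredDistVec {M : ℕ} (y : Fin M → ℝ) (t : EuclideanSpace ℝ (Pairs M)) :
    ⟪centredDistVec τ p M y, t⟫ = ∑ e, t e * centredDist τ p e y := by
  simp [centredDistVec, PiLp.inner_apply]

lemma isNClique_hardGraph_iff (hp : 0 < p) {r x : ℝ} (hr : 0 ≤ r) {d M N : ℕ} (hd : 0 < d)
    (hrd : r ^ max 1 p = d * meanDist τ p + x * √d) {s : Finset (Fin N)} (hs : s.card = M)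
    (X : Fin N → Fin d → ℝ) :
    (hardGraph p r X).IsNClique M s ↔ (√(d : ℝ))⁻¹ • ∑ k, centredDistVec τ p M
      (fun a => X (s.orderEmbOfFin hs a) k) ∈ orthant (Pairs M) x := by
  have hsd : 0 < √(d : ℝ) := Real.sqrt_pos.2 (by exact_mod_cast hd)
  have hadj : ∀ e : Pairs M,
      (hardGraph p r X).Adj (s.orderEmbOfFin hs e.1.1) (s.orderEmbOfFin hs e.1.2) ↔
      ((√(d : ℝ))⁻¹ • ∑ k, centredDistVec τ p M (fun a => X (s.orderEmbOfFin hs a) k)) e ≤ x := by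
    intro e
    have hne : s.orderEmbOfFin hs e.1.1 ≠ s.orderEmbOfFin hs e.1.2 :=
      (s.orderEmbOfFin hs).injective.ne e.2.ne
    have h1 : ((√(d : ℝ))⁻¹ • ∑ k, centredDistVec τ p M
        (fun a => X (s.orderEmbOfFin hs a) k)) e = (√(d : ℝ))⁻¹ *
        (∑ k, |X (s.orderEmbOfFin hs e.1.1) k - X (s.orderEmbOfFin hs e.1.2) k| ^ p -
          d * meanDist τ p) := by
      simp [centredDistVec, centredDist]
    rw [h1, inv_mul_le_iff₀ hsd]
    simp only [hardGraph, hne, ne_eq, not_false_eq_true, true_and, pDist_le_iff hp hr, hrd]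
    constructor <;> intro h <;> linarith
  rw [SimpleGraph.isNClique_iff, and_iff_left hs, SimpleGraph.isClique_iff]
  constructor
  · intro h e
    refine (hadj e).1 (h ?_ ?_ ((s.orderEmbOfFin hs).injective.ne e.2.ne))
    · exact s.orderEmbOfFin_mem hs _
    · exact s.orderEmbOfFin_mem hs _
  · intro h v hv w hw hvw
    rw [← Finset.range_orderEmbOfFin s hs] at hv hw
    obtain ⟨a, rfl⟩ := hv
    obtain ⟨b, rfl⟩ := hw
    have hab : a ≠ b := fun h => hvw (by rw [h])
    rcases lt_or_gt_of_ne hab with hlt | hlt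
    · exact (hadj ⟨(a, b), hlt⟩).2 (h _)
    · exact ((hadj ⟨(b, a), hlt⟩).2 (h _)).symm

lemma cliqueProb_eq [IsProbabilityMeasure τ] (hp : 0 < p) {r x : ℝ} (hr : 0 ≤ r) {d M N : ℕ}
    (hd : 0 < d) (hrd : r ^ max 1 p = d * meanDist τ p + x * √d) {s : Finset (Fin N)}
    (hs : s.card = M) :
    cliqueProb τ p d r M s = ((Measure.pi fun _ : Fin d => Measure.pi fun _ : Fin M => τ).map
      fun ω => (√(d : ℝ))⁻¹ • ∑ k, centredDistVec τ p M (ω k)).real (orthant (Pairs M) x) := by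
  have hm : Measurable fun ω : Fin d → Fin M → ℝ =>
      (√(d : ℝ))⁻¹ • ∑ k, centredDistVec τ p M (ω k) := by fun_prop
  have hmp := (measurePreserving_pi_swap (ι := Fin M) (κ := Fin d) τ).comp
    (measurePreserving_pi_comp_injective (Measure.pi fun _ : Fin d => τ)
      (s.orderEmbOfFin hs).injective)
  have hO := (isClosed_orthant (Pairs M) x).measurableSet
  rw [measureReal_def, Measure.map_apply hm hO,
    ← hmp.measure_preimage (hm hO).nullMeasurableSet, cliqueProb, nodeLaw, measureReal_def]
  congr 2
  ext X
  exact isNClique_hardGraph_iff hp hr hd hrd hs X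

theorem tendsto_cliqueProb [IsProbabilityMeasure τ] (hp : 0 < p)
    (hmom : Integrable (fun t : ℝ => |t| ^ (2 * p)) τ) (hτ : ∀ a : ℝ, τ ≠ Measure.dirac a)
    (M : ℕ) (x : ℝ) (r : ℕ → ℝ)
    (hr : ∀ᶠ d : ℕ in atTop, 0 ≤ r d ∧ r d ^ max 1 p = d * meanDist τ p + x * √d)
    (N : ℕ → ℕ) (s : ∀ d, Finset (Fin (N d))) (hs : ∀ d, (s d).card = M) :
    Tendsto (fun d => cliqueProb τ p d (r d) M (s d)) atTop (𝓝 (limitDensity τ p M x)) := by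
  have hS := posDef_covMatrix hp hmom hτ M
  rw [limitDensity_eq hp hmom hτ]
  refine (tendsto_multivariateGaussian (Measure.pi fun _ : Fin M => τ)
    (measurable_centredDistVec (τ := τ) (p := p) M) hS (fun t => ?_) (fun t => ?_)
    (multivariateGaussian_frontier_orthant hS x)).congr' ?_
  · simp only [inner_centredDistVec]
    rw [integral_finsetSum _ fun e _ =>
      ((memLp_centredDist hp hmom e).integrable one_le_two).const_mul _]
    simp [integral_const_mul, integral_centredDist hp hmom]
  · simp only [inner_centredDistVec]
    rw [dotProduct_covMatrix_mulVec hp hmom]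
  · filter_upwards [hr, eventually_gt_atTop 0] with d hd hd0
    exact (cliqueProb_eq hp hd.1 hd0 hd.2 (hs d)).symm

end Clique

/-! ### The Harris inequality -/

section Harris

lemma integrable_of_mem_Icc {Ω : Type*} [MeasurableSpace Ω] {P : Measure Ω} [IsFiniteMeasure P]
    {f : Ω → ℝ} (hf : Measurable f) (h : ∀ ω, f ω ∈ Set.Icc (0 : ℝ) 1) : Integrable f P :=
  Integrable.of_mem_Icc 0 1 hf.aemeasurable (ae_of_all _ h)

lemma mul_mem_Icc_zero_one {a b : ℝ} (ha : a ∈ Set.Icc (0 : ℝ) 1) (hb : b ∈ Set.Icc (0 : ℝ) 1) :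
    a * b ∈ Set.Icc (0 : ℝ) 1 :=
  ⟨mul_nonneg ha.1 hb.1, mul_le_one₀ ha.2 hb.1 hb.2⟩

lemma integral_mem_Icc {Ω : Type*} [MeasurableSpace Ω] {P : Measure Ω} [IsProbabilityMeasure P]
    {f : Ω → ℝ} (hf : Measurable f) (h : ∀ ω, f ω ∈ Set.Icc (0 : ℝ) 1) :
    ∫ ω, f ω ∂P ∈ Set.Icc (0 : ℝ) 1 := by
  refine ⟨integral_nonneg fun ω => (h ω).1, ?_⟩
  calc ∫ ω, f ω ∂P ≤ ∫ _, (1 : ℝ) ∂P :=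
        integral_mono (integrable_of_mem_Icc hf h) (integrable_const _) fun ω => (h ω).2
    _ = 1 := by simp

lemma chebyshev_integral_mul_le (P : Measure ℝ) [IsProbabilityMeasure P] {f g : ℝ → ℝ}
    (hf : Measurable f) (hg : Measurable g) (hf1 : ∀ x, f x ∈ Set.Icc (0 : ℝ) 1)
    (hg1 : ∀ x, g x ∈ Set.Icc (0 : ℝ) 1) (hfa : Antitone f) (hga : Antitone g) :
    (∫ x, f x ∂P) * ∫ x, g x ∂P ≤ ∫ x, f x * g x ∂P := by
  have hfi : Integrable f P := integrable_of_mem_Icc hf hf1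
  have hgi : Integrable g P := integrable_of_mem_Icc hg hg1
  have hfgi : Integrable (fun x => f x * g x) P :=
    integrable_of_mem_Icc (hf.mul hg) fun x => mul_mem_Icc_zero_one (hf1 x) (hg1 x)
  have h0 : 0 ≤ ∫ x, ∫ y, (f x - f y) * (g x - g y) ∂P ∂P := by
    refine integral_nonneg fun x => integral_nonneg fun y => ?_
    rcases le_total x y with h | h
    · exact mul_nonneg (sub_nonneg.2 (hfa h)) (sub_nonneg.2 (hga h))
    · exact mul_nonneg_of_nonpos_of_nonpos (sub_nonpos.2 (hfa h)) (sub_nonpos.2 (hga h))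
  have h1 : ∀ x, ∫ y, (f x - f y) * (g x - g y) ∂P =
      f x * g x - f x * (∫ y, g y ∂P) - g x * (∫ y, f y ∂P) + ∫ y, f y * g y ∂P := by
    intro x
    have : ∀ y, (f x - f y) * (g x - g y) = f x * g x - f x * g y - g x * f y + f y * g y :=
      fun y => by ring
    simp only [this]
    rw [integral_add _ hfgi, integral_sub _ (hfi.const_mul _), integral_sub _ (hgi.const_mul _),
      integral_const_mul, integral_const_mul]
    · simp [integral_const_mul]
    · exact integrable_const _
    · exact (integrable_const _).sub (hgi.const_mul _)
    · exact ((integrable_const _).sub (hgi.const_mul _)).sub (hfi.const_mul _)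
  simp only [h1] at h0
  rw [integral_add _ (integrable_const _), integral_sub _ (hgi.mul_const _),
    integral_sub hfgi (hfi.mul_const _), integral_mul_const, integral_mul_const] at h0
  · simp at h0
    linarith
  · exact hfgi.sub (hfi.mul_const _)
  · exact (hfgi.sub (hfi.mul_const _)).sub (hgi.mul_const _)

theorem harris_integral_mul_le (P : Measure ℝ) [IsProbabilityMeasure P] {n : ℕ}
    {f g : (Fin n → ℝ) → ℝ} (hf : Measurable f) (hg : Measurable g)
    (hf1 : ∀ x, f x ∈ Set.Icc (0 : ℝ) 1) (hg1 : ∀ x, g x ∈ Set.Icc (0 : ℝ) 1)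
    (hfa : Antitone f) (hga : Antitone g) :
    (∫ x, f x ∂(Measure.pi fun _ => P)) * ∫ x, g x ∂(Measure.pi fun _ => P) ≤
      ∫ x, f x * g x ∂(Measure.pi fun _ => P) := by
  induction n with
  | zero =>
    rw [integral_unique, integral_unique, integral_unique]
    simp
  | succ n ih =>
    have hcons : Measurable fun z : ℝ × (Fin n → ℝ) => (Fin.cons z.1 z.2 : Fin (n + 1) → ℝ) := by
      refine measurable_pi_lambda _ fun i => ?_
      refine Fin.cases ?_ (fun j => ?_) i
      · simpa using measurable_fst
      · simp only [Fin.cons_succ]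
        exact (measurable_pi_apply j).comp measurable_snd
    have hcons' : ∀ x : ℝ, Measurable fun z : Fin n → ℝ => (Fin.cons x z : Fin (n + 1) → ℝ) :=
      fun x => hcons.comp measurable_prodMk_left
    have hle : ∀ {x x' : ℝ} {z z' : Fin n → ℝ}, x ≤ x' → z ≤ z' →
        (Fin.cons x z : Fin (n + 1) → ℝ) ≤ Fin.cons x' z' := by
      intro x x' z z' hx hz
      exact Fin.cons_le_cons.2 ⟨hx, hz⟩
    have key : ∀ h : (Fin (n + 1) → ℝ) → ℝ, Measurable h → (∀ x, h x ∈ Set.Icc (0 : ℝ) 1) →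
        Antitone h → Measurable (fun x => ∫ z, h (Fin.cons x z) ∂(Measure.pi fun _ => P)) ∧
        (∀ x, ∫ z, h (Fin.cons x z) ∂(Measure.pi fun _ => P) ∈ Set.Icc (0 : ℝ) 1) ∧
        Antitone (fun x => ∫ z, h (Fin.cons x z) ∂(Measure.pi fun _ => P)) := by
      intro h hm h1 ha
      refine ⟨?_, fun x => integral_mem_Icc (hm.comp (hcons' x)) fun z => h1 _, fun x x' hx => ?_⟩
      · exact (StronglyMeasurable.integral_prod_right
          (f := fun (x : ℝ) (z : Fin n → ℝ) => h (Fin.cons x z))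
          (hm.comp hcons).stronglyMeasurable).measurable
      · exact integral_mono (integrable_of_mem_Icc (hm.comp (hcons' x')) fun z => h1 _)
          (integrable_of_mem_Icc (hm.comp (hcons' x)) fun z => h1 _)
          fun z => ha (hle hx le_rfl)
    obtain ⟨f1, f2, f3⟩ := key f hf hf1 hfa
    obtain ⟨g1, g2, g3⟩ := key g hg hg1 hga
    have hfg1 : ∀ x, f x * g x ∈ Set.Icc (0 : ℝ) 1 := fun x => mul_mem_Icc_zero_one (hf1 x) (hg1 x)
    have hfgi := integral_pi_succ P _
      (integrable_of_mem_Icc (P := Measure.pi fun _ => P) (hf.mul hg) hfg1)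
    rw [(integral_pi_succ P f (integrable_of_mem_Icc hf hf1)).2,
      (integral_pi_succ P g (integrable_of_mem_Icc hg hg1)).2]
    refine (chebyshev_integral_mul_le P f1 g1 f2 g2 f3 g3).trans ?_
    refine le_of_le_of_eq ?_ hfgi.2.symm
    refine integral_mono (integrable_of_mem_Icc (f1.mul g1)
      fun x => mul_mem_Icc_zero_one (f2 x) (g2 x)) hfgi.1.integral_prod_left fun x => ?_
    exact ih (hf.comp (hcons' x)) (hg.comp (hcons' x)) (fun z => hf1 _) (fun z => hg1 _)
      (fun z z' hz => hfa (hle le_rfl hz)) (fun z z' hz => hga (hle le_rfl hz))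

lemma prod_mem_Icc_zero_one {ι : Type*} (T : Finset ι) {a : ι → ℝ}
    (ha : ∀ i, a i ∈ Set.Icc (0 : ℝ) 1) : ∏ i ∈ T, a i ∈ Set.Icc (0 : ℝ) 1 :=
  ⟨Finset.prod_nonneg fun i _ => (ha i).1, Finset.prod_le_one (fun i _ => (ha i).1)
    fun i _ => (ha i).2⟩

lemma antitone_finset_prod {ι α : Type*} [Preorder α] (T : Finset ι) {f : ι → α → ℝ}
    (h0 : ∀ i x, 0 ≤ f i x) (ha : ∀ i, Antitone (f i)) : Antitone fun x => ∏ i ∈ T, f i x :=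
  fun _ _ h => Finset.prod_le_prod (fun i _ => h0 i _) fun i _ => ha i h

theorem prod_integral_le_integral_prod (P : Measure ℝ) [IsProbabilityMeasure P] {n : ℕ}
    {ι : Type*} {f : ι → (Fin n → ℝ) → ℝ} (hf : ∀ i, Measurable (f i))
    (hf1 : ∀ i x, f i x ∈ Set.Icc (0 : ℝ) 1) (hfa : ∀ i, Antitone (f i)) (T : Finset ι) :
    ∏ i ∈ T, ∫ x, f i x ∂(Measure.pi fun _ => P) ≤
      ∫ x, ∏ i ∈ T, f i x ∂(Measure.pi fun _ => P) := by
  classical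
  induction T using Finset.induction_on with
  | empty => simp
  | insert i T hi ih =>
    simp only [Finset.prod_insert hi]
    refine (mul_le_mul_of_nonneg_left ih (integral_mem_Icc (hf i) (hf1 i)).1).trans ?_
    exact harris_integral_mul_le P (hf i) (Finset.measurable_fun_prod _ fun i _ => hf i) (hf1 i)
      (fun x => prod_mem_Icc_zero_one T fun i => hf1 i x) (hfa i)
      (antitone_finset_prod T (fun i x => (hf1 i x).1) hfa)

/-! ### Strict correlation of pairs that share a node -/

variable {P : Measure ℝ} [IsProbabilityMeasure P] {φ : ℝ → ℝ}

lemma strictAnti_integral_add (hφ : Measurable φ) (hφ1 : ∀ s, φ s ∈ Set.Icc (0 : ℝ) 1)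
    (hφa : StrictAnti φ) : StrictAnti fun x => ∫ y, φ (x + y) ∂P := by
  intro a b hab
  have hi : ∀ x, Integrable (fun y => φ (x + y)) P := fun x =>
    integrable_of_mem_Icc (by fun_prop) fun y => hφ1 _
  have hpos : ∀ y, 0 < φ (a + y) - φ (b + y) := fun y => sub_pos.2 (hφa (by linarith))
  have h : 0 < ∫ y, (φ (a + y) - φ (b + y)) ∂P := by
    rw [integral_pos_iff_support_of_nonneg (fun y => (hpos y).le) ((hi a).sub (hi b))]
    have : (Function.support fun y => φ (a + y) - φ (b + y)) = Set.univ :=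
      Set.eq_univ_of_forall fun y => (hpos y).ne'
    rw [this]
    simp
  rw [integral_sub (hi a) (hi b)] at h
  simpa using h

lemma sq_integral_lt_integral_sq [NullSingletonClass P] {g : ℝ → ℝ} (hg : Measurable g)
    (hg1 : ∀ x, g x ∈ Set.Icc (0 : ℝ) 1) (hga : StrictAnti g) :
    (∫ x, g x ∂P) ^ 2 < ∫ x, g x ^ 2 ∂P := by
  have hL : MemLp g 2 P := by
    rw [memLp_two_iff_integrable_sq hg.aestronglyMeasurable]
    simp only [sq]
    exact integrable_of_mem_Icc (hg.mul hg) fun x => mul_mem_Icc_zero_one (hg1 x) (hg1 x)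
  have hv : Var[g; P] = ∫ x, g x ^ 2 ∂P - (∫ x, g x ∂P) ^ 2 := variance_eq_sub hL
  rcases (variance_nonneg g P).lt_or_eq with h | h
  · linarith
  · have hae := ae_eq_integral_of_variance_eq_zero hL h.symm
    have h0 : P {x | g x = ∫ x, g x ∂P} = 0 :=
      Set.Subsingleton.measure_zero (fun x hx y hy => hga.injective (hx.trans hy.symm)) P
    have h1 : ∀ᵐ x ∂P, g x ≠ ∫ x, g x ∂P := compl_mem_ae_iff.2 h0
    obtain ⟨x, hx, hx'⟩ := (hae.and h1).exists
    exact absurd hx hx'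

lemma integral_add_pair (hφ : Measurable φ) (hφ1 : ∀ s, φ s ∈ Set.Icc (0 : ℝ) 1) {M : ℕ}
    (e : Pairs M) : ∫ w, φ (w e.1.1 + w e.1.2) ∂(Measure.pi fun _ => P) =
      ∫ x, ∫ y, φ (x + y) ∂P ∂P := by
  have he : Function.Injective ![e.1.1, e.1.2] := by
    have := e.2.ne
    intro a b; fin_cases a <;> fin_cases b <;> simp [this, this.symm]
  have h := integral_comp_injective P he (F := fun w => φ (w 0 + w 1)) (by fun_prop)
  exact h.trans (integral_pi_two P (fun x y => φ (x + y))
    (integrable_of_mem_Icc (by fun_prop) fun w => hφ1 _))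

theorem pow_card_lt_integral_prod [NullSingletonClass P] (hφ : Measurable φ)
    (hφ1 : ∀ s, φ s ∈ Set.Ioc (0 : ℝ) 1) (hφa : StrictAnti φ) {M : ℕ} (hM : 3 ≤ M) :
    (∫ x, ∫ y, φ (x + y) ∂P ∂P) ^ Fintype.card (Pairs M) <
      ∫ w, ∏ e : Pairs M, φ (w e.1.1 + w e.1.2) ∂(Measure.pi fun _ => P) := by
  have hφ1' : ∀ s, φ s ∈ Set.Icc (0 : ℝ) 1 := fun s => Set.Ioc_subset_Icc_self (hφ1 s)
  let f : Pairs M → (Fin M → ℝ) → ℝ := fun e w => φ (w e.1.1 + w e.1.2)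
  have hf : ∀ e, Measurable (f e) := fun e => by fun_prop
  have hf1 : ∀ e w, f e w ∈ Set.Icc (0 : ℝ) 1 := fun e w => hφ1' _
  have hfa : ∀ e, Antitone (f e) := fun e w w' h =>
    hφa.antitone (add_le_add (h _) (h _))
  set c := ∫ x, ∫ y, φ (x + y) ∂P ∂P with hc
  have hfc : ∀ e, ∫ w, f e w ∂(Measure.pi fun _ => P) = c := fun e => integral_add_pair hφ hφ1' e
  let i0 : Fin M := ⟨0, by omega⟩
  let i1 : Fin M := ⟨1, by omega⟩
  let i2 : Fin M := ⟨2, by omega⟩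
  let e1 : Pairs M := ⟨(i0, i1), by simp [i0, i1]⟩
  let e2 : Pairs M := ⟨(i0, i2), by simp [i0, i2]⟩
  have he12 : e1 ≠ e2 := by simp [e1, e2, i1, i2]
  let g : ℝ → ℝ := fun x => ∫ y, φ (x + y) ∂P
  have hg : Measurable g := (StronglyMeasurable.integral_prod_right
    (f := fun x y => φ (x + y)) (by
      exact Measurable.stronglyMeasurable (by unfold Function.uncurry; fun_prop))).measurable
  have hg1 : ∀ x, g x ∈ Set.Icc (0 : ℝ) 1 := fun x =>
    integral_mem_Icc (by fun_prop) fun y => hφ1' _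
  have hga : StrictAnti g := strictAnti_integral_add hφ hφ1' hφa
  have hshare : c ^ 2 < ∫ w, f e1 w * f e2 w ∂(Measure.pi fun _ => P) := by
    have he : Function.Injective ![i0, i1, i2] := by
      intro a b; fin_cases a <;> fin_cases b <;> simp [i0, i1, i2]
    have h := integral_comp_injective P he (F := fun w => φ (w 0 + w 1) * φ (w 0 + w 2))
      (by fun_prop)
    have h2 := integral_pi_three P (fun x y z => φ (x + y) * φ (x + z))
      (integrable_of_mem_Icc (by fun_prop) fun w => mul_mem_Icc_zero_one (hφ1' _) (hφ1' _))
    refine lt_of_lt_of_eq ?_ (h.trans h2).symm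
    simp only [integral_const_mul, integral_mul_const, ← sq]
    exact sq_integral_lt_integral_sq hg hg1 hga
  have hcpos : 0 < c := by
    have hgpos : ∀ x, 0 < g x := by
      intro x
      exact lt_of_le_of_lt (hg1 (x + 1)).1 (hga (lt_add_one x))
    rw [hc, integral_pos_iff_support_of_nonneg (fun x => (hgpos x).le)
      (integrable_of_mem_Icc hg hg1)]
    have : Function.support (fun x => ∫ y, φ (x + y) ∂P) = Set.univ :=
      Set.eq_univ_of_forall fun x => (hgpos x).ne'
    rw [this]
    simp
  let T : Finset (Pairs M) := (Finset.univ.erase e1).erase e2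
  have hsplit : ∀ h : Pairs M → ℝ, ∏ e, h e = h e1 * h e2 * ∏ e ∈ T, h e := by
    intro h
    rw [← Finset.mul_prod_erase _ _ (Finset.mem_univ e1),
      ← Finset.mul_prod_erase (Finset.univ.erase e1) _
        (Finset.mem_erase.2 ⟨he12.symm, Finset.mem_univ e2⟩), mul_assoc]
  calc c ^ Fintype.card (Pairs M) = ∏ _e : Pairs M, c := by simp
    _ = c ^ 2 * ∏ _e ∈ T, c := by rw [hsplit, sq]
    _ < (∫ w, f e1 w * f e2 w ∂(Measure.pi fun _ => P)) * ∏ _e ∈ T, c :=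
        mul_lt_mul_of_pos_right hshare (Finset.prod_pos fun _ _ => hcpos)
    _ ≤ (∫ w, f e1 w * f e2 w ∂(Measure.pi fun _ => P)) *
        ∫ w, ∏ e ∈ T, f e w ∂(Measure.pi fun _ => P) := by
        refine mul_le_mul_of_nonneg_left ?_ ((sq_nonneg c).trans hshare.le)
        have := prod_integral_le_integral_prod P hf hf1 hfa T
        simpa only [hfc] using this
    _ ≤ ∫ w, f e1 w * f e2 w * ∏ e ∈ T, f e w ∂(Measure.pi fun _ => P) := by
        refine harris_integral_mul_le P ((hf e1).mul (hf e2))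
          (Finset.measurable_fun_prod _ fun i _ => hf i)
          (fun w => mul_mem_Icc_zero_one (hf1 _ w) (hf1 _ w))
          (fun w => prod_mem_Icc_zero_one T fun i => hf1 i w) (fun w w' h => ?_)
          (antitone_finset_prod T (fun i x => (hf1 i x).1) hfa)
        exact mul_le_mul (hfa e1 h) (hfa e2 h) (hf1 _ _).1 (hf1 _ _).1
    _ = ∫ w, ∏ e : Pairs M, φ (w e.1.1 + w e.1.2) ∂(Measure.pi fun _ => P) := by
        simp only [hsplit, f]

end Harris

/-! ### Comparison with the Erdős–Rényi graph -/

section Omega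

lemma card_pairs (M : ℕ) : Fintype.card (Pairs M) = M.choose 2 := by
  have h1 : ∀ j : Fin M, ∑ i : Fin M, (if i < j then 1 else 0) = (j : ℕ) := by
    intro j
    rw [← Finset.card_filter, ← Fin.card_Iio j]
    congr 1
    ext i
    simp
  rw [Fintype.card_subtype, Finset.card_filter, Fintype.sum_prod_type, Finset.sum_comm]
  simp only [h1]
  rw [Fin.sum_univ_eq_sum_range (fun i => i), Finset.sum_range_id, Nat.choose_two_right]

lemma integral_exp_pi_gaussianReal {ι : Type*} [Fintype ι] (c : ι → ℝ) :
    ∫ z : ι → ℝ, Complex.exp (((∑ i, c i * z i : ℝ) : ℂ) * Complex.I)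
      ∂(Measure.pi fun _ => gaussianReal 0 1) = Complex.exp (-((∑ i, c i ^ 2 : ℝ) : ℂ) / 2) := by
  have h1 : ∀ z : ι → ℝ, Complex.exp (((∑ i, c i * z i : ℝ) : ℂ) * Complex.I) =
      ∏ i, Complex.exp ((c i : ℂ) * (z i : ℂ) * Complex.I) := by
    intro z
    rw [← Complex.exp_sum, Complex.ofReal_sum, Finset.sum_mul]
    simp only [Complex.ofReal_mul]
  simp only [h1]
  rw [integral_fintype_prod_eq_prod (fun i (x : ℝ) => Complex.exp ((c i : ℂ) * (x : ℂ) * Complex.I))]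
  have h2 : ∀ i, ∫ x : ℝ, Complex.exp ((c i : ℂ) * (x : ℂ) * Complex.I) ∂gaussianReal 0 1 =
      Complex.exp (-((c i ^ 2 : ℝ) : ℂ) / 2) := by
    intro i
    rw [← charFun_apply_real, charFun_gaussianReal]
    simp [neg_div]
  simp only [h2]
  rw [← Complex.exp_sum, Complex.ofReal_sum, ← Finset.sum_div, Finset.sum_neg_distrib]

variable {τ : Measure ℝ} {p : ℝ}

lemma multivariateGaussian_eq_map {M : ℕ} (a b : ℝ) {S : Matrix (Pairs M) (Pairs M) ℝ}
    (hS : S.PosDef) (h : S = a ^ 2 • (1 : Matrix (Pairs M) (Pairs M) ℝ) +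
      b ^ 2 • ((incidence M).transpose * incidence M)) :
    multivariateGaussian 0 S =
      ((Measure.pi fun _ : Fin M => gaussianReal 0 1).prod
        (Measure.pi fun _ : Pairs M => gaussianReal 0 1)).map
      fun z => WithLp.toLp 2 fun e => a * z.2 e + b * (z.1 e.1.1 + z.1 e.1.2) := by
  have hm : Measurable fun z : (Fin M → ℝ) × (Pairs M → ℝ) =>
      (WithLp.toLp 2 fun e => a * z.2 e + b * (z.1 e.1.1 + z.1 e.1.2) :
        EuclideanSpace ℝ (Pairs M)) := by fun_prop
  refine Measure.ext_of_charFun (funext fun t => ?_)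
  rw [charFun_multivariateGaussian hS.posSemidef, charFun_apply,
    integral_map hm.aemeasurable (by fun_prop)]
  have h1 : ∀ z : (Fin M → ℝ) × (Pairs M → ℝ),
      Complex.exp (inner ℝ (WithLp.toLp 2 fun e => a * z.2 e + b * (z.1 e.1.1 + z.1 e.1.2)) t *
        Complex.I) =
      Complex.exp (((∑ v, (b * (incidence M).mulVec t.ofLp v) * z.1 v : ℝ) : ℂ) * Complex.I) *
      Complex.exp (((∑ e, (a * t e) * z.2 e : ℝ) : ℂ) * Complex.I) := by
    intro z
    rw [← Complex.exp_add, ← add_mul, ← Complex.ofReal_add]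
    congr 3
    have h2 : ∑ v, (b * (incidence M).mulVec t.ofLp v) * z.1 v =
        ∑ e, b * t e * (z.1 e.1.1 + z.1 e.1.2) := by
      simp only [Matrix.mulVec, dotProduct, Finset.mul_sum, Finset.sum_mul]
      rw [Finset.sum_comm]
      refine Finset.sum_congr rfl fun e _ => ?_
      rw [← sum_incidence_mul e z.1, Finset.mul_sum]
      exact Finset.sum_congr rfl fun v _ => by ring
    rw [h2, ← Finset.sum_add_distrib]
    simp only [PiLp.inner_apply, RCLike.inner_apply, conj_trivial]
    exact Finset.sum_congr rfl fun e _ => by ring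
  simp only [h1]
  rw [integral_prod_mul (fun w : Fin M → ℝ =>
      Complex.exp (((∑ v, (b * (incidence M).mulVec t.ofLp v) * w v : ℝ) : ℂ) * Complex.I))
    (fun w : Pairs M → ℝ => Complex.exp (((∑ e, (a * t e) * w e : ℝ) : ℂ) * Complex.I)),
    integral_exp_pi_gaussianReal, integral_exp_pi_gaussianReal, ← Complex.exp_add]
  congr 1
  have h3 : t.ofLp ⬝ᵥ S.mulVec t.ofLp =
      ∑ v, (b * (incidence M).mulVec t.ofLp v) ^ 2 + ∑ e, (a * t e) ^ 2 := by
    rw [h, Matrix.add_mulVec, Matrix.smul_mulVec, Matrix.smul_mulVec, Matrix.one_mulVec,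
      ← Matrix.mulVec_mulVec, dotProduct_add, dotProduct_smul, dotProduct_smul,
      Matrix.mulVec_transpose, dotProduct_comm, dotProduct_comm t.ofLp (Matrix.vecMul _ _),
      ← Matrix.dotProduct_mulVec, add_comm]
    simp only [dotProduct, smul_eq_mul, Finset.mul_sum]
    congr 1 <;> exact Finset.sum_congr rfl fun e _ => by ring
  rw [h3]
  simp only [inner_zero_right]
  push_cast
  ring

lemma multivariateGaussian_orthant_eq_integral {M : ℕ} {a b : ℝ} (ha : 0 < a)
    {S : Matrix (Pairs M) (Pairs M) ℝ} (hS : S.PosDef)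
    (h : S = a ^ 2 • (1 : Matrix (Pairs M) (Pairs M) ℝ) +
      b ^ 2 • ((incidence M).transpose * incidence M)) (x : ℝ) :
    (multivariateGaussian 0 S).real (orthant (Pairs M) x) =
      ∫ w : Fin M → ℝ, ∏ e : Pairs M,
        (gaussianReal 0 1).real (Set.Iic ((x - b * (w e.1.1 + w e.1.2)) / a))
        ∂(Measure.pi fun _ => gaussianReal 0 1) := by
  have hm : Measurable fun z : (Fin M → ℝ) × (Pairs M → ℝ) =>
      (WithLp.toLp 2 fun e => a * z.2 e + b * (z.1 e.1.1 + z.1 e.1.2) :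
        EuclideanSpace ℝ (Pairs M)) := by fun_prop
  have hO := (isClosed_orthant (Pairs M) x).measurableSet
  rw [multivariateGaussian_eq_map a b hS h, measureReal_def, Measure.map_apply hm hO,
    Measure.prod_apply (hm hO)]
  have hset : ∀ w : Fin M → ℝ, Prod.mk w ⁻¹' ((fun z : (Fin M → ℝ) × (Pairs M → ℝ) =>
      (WithLp.toLp 2 fun e => a * z.2 e + b * (z.1 e.1.1 + z.1 e.1.2) :
        EuclideanSpace ℝ (Pairs M))) ⁻¹' orthant (Pairs M) x) =
      Set.univ.pi fun e : Pairs M => Set.Iic ((x - b * (w e.1.1 + w e.1.2)) / a) := by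
    intro w
    ext z
    simp only [orthant, Set.mem_preimage, Set.mem_ofPred_eq, Set.mem_univ_pi, Set.mem_Iic]
    refine forall_congr' fun e => ?_
    rw [le_div_iff₀ ha]
    constructor <;> intro h <;> linarith
  simp only [hset, Measure.pi_pi]
  rw [← integral_toReal]
  · simp only [ENNReal.toReal_prod, measureReal_def]
  · refine Measurable.aemeasurable ?_
    have := measurable_measure_prodMk_left (ν := Measure.pi fun _ : Pairs M => gaussianReal 0 1)
      (hm hO)
    simpa only [hset, Measure.pi_pi] using this
  · refine ae_of_all _ fun w => ?_
    rw [← Measure.pi_pi (fun _ : Pairs M => gaussianReal 0 1)]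
    exact measure_lt_top _ _

theorem omegaHard_ne_pow [IsProbabilityMeasure τ] (hp : 0 < p)
    (hmom : Integrable (fun t : ℝ => |t| ^ (2 * p)) τ) (hτ : ∀ a : ℝ, τ ≠ Measure.dirac a)
    {M : ℕ} (hM : 3 ≤ M) (hβ : triCorr τ p ≠ 0) {u : ℝ} (hu : u ∈ Set.Ioo (0 : ℝ) 1) :
    omegaHard τ p M u ≠ u ^ M.choose 2 := by
  obtain ⟨x, -, hx⟩ := (bijOn_limitDensity_two hp hmom hτ).surjOn hu
  have hinv : limitDensity τ p 2 (Function.invFun (limitDensity τ p 2) u) = u :=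
    Function.invFun_eq ⟨x, hx⟩
  rw [omegaHard]
  generalize Function.invFun (limitDensity τ p 2) u = x at hinv
  have hβ' : 0 < triCorr τ p := lt_of_le_of_ne (triCorr_nonneg hp hmom) hβ.symm
  have hαβ : 0 < diagCorr τ p - 2 * triCorr τ p :=
    sub_pos.2 (two_mul_triCorr_lt_diagCorr hp hmom hτ)
  obtain ⟨a, ha, ha2⟩ : ∃ a : ℝ, 0 < a ∧ a ^ 2 = diagCorr τ p - 2 * triCorr τ p :=
    ⟨_, Real.sqrt_pos.2 hαβ, Real.sq_sqrt hαβ.le⟩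
  obtain ⟨b, hb, hb2⟩ : ∃ b : ℝ, 0 < b ∧ b ^ 2 = triCorr τ p :=
    ⟨_, Real.sqrt_pos.2 hβ', Real.sq_sqrt hβ'.le⟩
  set φ : ℝ → ℝ := fun s => (gaussianReal 0 1).real (Set.Iic ((x - b * s) / a)) with hφ
  have hlim : ∀ M, limitDensity τ p M x = ∫ w : Fin M → ℝ, ∏ e : Pairs M,
      φ (w e.1.1 + w e.1.2) ∂(Measure.pi fun _ => gaussianReal 0 1) := by
    intro M
    rw [limitDensity_eq hp hmom hτ]
    refine multivariateGaussian_orthant_eq_integral ha (posDef_covMatrix hp hmom hτ M) ?_ x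
    rw [ha2, hb2]
    exact covMatrix_eq_incidence hp hmom M
  have hmono := strictMono_gaussianReal_Iic one_pos
  rw [Real.toNNReal_one] at hmono
  have hanti : StrictAnti φ := by
    intro s t hst
    refine hmono ?_
    gcongr
  have hφ1 : ∀ s, φ s ∈ Set.Ioc (0 : ℝ) 1 := fun s =>
    ⟨lt_of_le_of_lt measureReal_nonneg (hanti (lt_add_one s)), measureReal_le_one⟩
  have hφm : Measurable φ := hanti.antitone.measurable
  have := nullSingletonClass_gaussianReal (μ := 0) (v := 1) one_ne_zero
  have hmain := pow_card_lt_integral_prod (P := gaussianReal 0 1) hφm hφ1 hanti hM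
  have hc : u = ∫ y, ∫ z, φ (y + z) ∂gaussianReal 0 1 ∂gaussianReal 0 1 := by
    rw [← hinv, hlim, ← integral_add_pair hφm (fun s => Set.Ioc_subset_Icc_self (hφ1 s))
      (default : Pairs 2)]
    simp
  rw [hlim, ← card_pairs, hc]
  exact hmain.ne'

end Omega

end HighDimRGG

end

theorem mainTheorem2 (τ : MeasureTheory.Measure ℝ) [MeasureTheory.IsProbabilityMeasure τ]
    (p : ℝ) (hp : 0 < p)
    (hmom : MeasureTheory.Integrable (fun t : ℝ => |t| ^ (2 * p)) τ)
    (hτ : ∀ a : ℝ, τ ≠ MeasureTheory.Measure.dirac a) (M : ℕ) :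
    (HighDimRGG.covMatrix τ p M =
        HighDimRGG.diagCorr τ p • (1 : Matrix (HighDimRGG.Pairs M) (HighDimRGG.Pairs M) ℝ) +
          HighDimRGG.triCorr τ p • (HighDimRGG.johnsonGraph M).adjMatrix ℝ ∧
      (HighDimRGG.covMatrix τ p M).PosDef) ∧
    (∀ (x : ℝ) (r : ℕ → ℝ),
      (∀ᶠ d : ℕ in Filter.atTop, 0 ≤ r d ∧
        r d ^ max 1 p = d * HighDimRGG.meanDist τ p + x * Real.sqrt d) →
      ∀ (N : ℕ → ℕ) (s : ∀ d, Finset (Fin (N d))), (∀ d, (s d).card = M) →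
        Filter.Tendsto (fun d => HighDimRGG.cliqueProb τ p d (r d) M (s d)) Filter.atTop
          (nhds (HighDimRGG.limitDensity τ p M x))) ∧
    (0 < HighDimRGG.diagCorr τ p ∧
      ∀ x : ℝ, HighDimRGG.limitDensity τ p 2 x =
        1 / 2 * (1 + HighDimRGG.erf (x / Real.sqrt (2 * HighDimRGG.diagCorr τ p)))) ∧
    (Set.BijOn (HighDimRGG.limitDensity τ p 2) Set.univ (Set.Ioo 0 1) ∧
      (3 ≤ M → HighDimRGG.triCorr τ p ≠ 0 → ∀ u ∈ Set.Ioo (0 : ℝ) 1,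
        HighDimRGG.omegaHard τ p M u ≠ u ^ M.choose 2) ∧
      HighDimRGG.triCorr (MeasureTheory.volume.restrict (Set.Icc (0 : ℝ) 1)) p ≠ 0) := by
  open HighDimRGG in
  exact ⟨⟨covMatrix_eq hp hmom M, posDef_covMatrix hp hmom hτ M⟩,
    fun x r hr N s hs => tendsto_cliqueProb hp hmom hτ M x r hr N s hs,
    ⟨diagCorr_pos hp hmom hτ, fun x => (limitDensity_two_eq_gaussianReal hp hmom hτ x).trans
      (gaussianReal_Iic (diagCorr_pos hp hmom hτ) x)⟩,
    bijOn_limitDensity_two hp hmom hτ,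
    fun hM hβ _ hu => omegaHard_ne_pow hp hmom hτ hM hβ hu, triCorr_uniform_ne_zero hp⟩
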